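/- **Cross-spectra of amplified Gaussian signals.** Let $x_1,\dots,x_M$ be complex-valued (jointly measurable) stochastic processes on $\mathbb R$ that are jointly circularly symmetric Gaussian and jointly stationary, with cross-correlations $R_{x_mx_{m'}}(\tau)=\mathbb E[x_m(t)x_{m'}^*(t-\tau)]$ and powers $\sigma_{x_m}^2=\mathbb E|x_m(t)|^2$. An integrable function $S$ on $\mathbb R$ is called the spectrum belonging to a correlation function $R$ if $R(\tau)=\int_{-\infty}^\infty S(f)e^{j2\pi f\tau}\,df$ for all $\tau$ (that is, $S$ is the Fourier transform of $R$; it is unique up to null sets). Assume that every $R_{x_mx_{m'}}$ has a spectrum $S_{x_mx_{m'}}$. Let $\Pi\in\mathbb N$, let $b_\varpi\in L^1(\mathbb R)$ for odd $\varpi\in[1,\Pi]$, and let the amplified signals be $$y_m(t)=\sum_{\varpi\in[1,\Pi]:\,\text{odd}}\int_{-\infty}^\infty b_\varpi(t-\tau)\,x_m(\tau)|x_m(\tau)|^{\varpi-1}\,d\tau .$$ For odd $\varpi$ put $$H_\varpi(z)=\sum_{i=0}^{\frac{\varpi-1}2}(-1)^i\,i!\binom{\frac{\varpi+1}2}{i}\binom{\frac{\varpi-1}2}{i}\,z\,|z|^{\varpi-1-2i},$$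 $$a_{\varpi m}(\tau)=\sum_{\kappa\in[\varpi,\Pi]:\,\text{odd}} \left(\tfrac{\kappa-\varpi}2\right)!\binom{\frac{\kappa+1}2}{\frac{\kappa-\varpi}2}\binom{\frac{\kappa-1}2}{\frac{\kappa-\varpi}2}\,\sigma_{x_m}^{\kappa-\varpi}\,b_\kappa(\tau),$$ let $A_{\varpi m}(f)=\int_{-\infty}^\infty a_{\varpi m}(\tau)e^{-j2\pi f\tau}\,d\tau$, and define the linear part and the distortion by $$u_m(t)=\int_{-\infty}^\infty a_{1m}(t-\tau)x_m(\tau)\,d\tau,\qquad d_m(t)=\sum_{\varpi\in[3,\Pi]:\,\text{odd}}\int_{-\infty}^\infty a_{\varpi m}(t-\tau)\,\sigma_{x_m}^{\varpi}H_\varpi\!\left(\frac{x_m(\tau)}{\sigma_{x_m}}\right)d\tau$$ (the integrand of $d_m$ is read as $0$ if $\sigma_{x_m}=0$). Then: 1. For every $t$ all these integrals converge absolutely almost surely, and $y_m(t)=u_m(t)+d_m(t)$ almost surely. Each of the families $(y_m)_m$, $(u_m)_m$, $(d_m)_m$ is jointly weak-sense stationary (finite second moments, constant means, cross-correlations independent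 of $t$). 2. The linear part and the distortion are uncorrelated: $\mathbb E[u_m(t)d_{m'}^*(t-\tau)]=0$ for all $m,m',t,\tau$. 3. For odd $\varpi\in[1,\Pi]$, the function $R^{(\varpi)}_{x_mx_{m'}}=\left(\frac{\varpi+1}2\right)!\left(\frac{\varpi-1}2\right)!\,R_{x_mx_{m'}}|R_{x_mx_{m'}}|^{\varpi-1}$ has the spectrum $$S^{(\varpi)}_{x_mx_{m'}}(f)=\left(\tfrac{\varpi+1}2\right)!\left(\tfrac{\varpi-1}2\right)!\Bigl(\underbrace{S_{x_mx_{m'}}(\varphi)\star\cdots\star S_{x_mx_{m'}}(\varphi)}_{\frac{\varpi+1}2\text{ factors}}\star\underbrace{S^*_{x_mx_{m'}}(-\varphi)\star\cdots\star S^*_{x_mx_{m'}}(-\varphi)}_{\frac{\varpi-1}2\text{ factors}}\Bigr)(f).$$ 4. The cross-correlations of the $y_m$, of the $u_m$ and of the $d_m$ have the spectra $$S_{y_my_{m'}}(f)=\sum_{\varpi\in[1,\Pi]:\,\text{odd}}A_{\varpi m}(f)A_{\varpi m'}^*(f)S^{(\varpi)}_{x_mx_{m'}}(f),\qquad S_{u_mu_{m'}}(f)=A_{1m}(f)A^*_{1m'}(f)S_{x_mx_{m'}}(f),$$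 $$S_{d_md_{m'}}(f)=\sum_{\varpi\in[3,\Pi]:\,\text{odd}}A_{\varpi m}(f)A_{\varpi m'}^*(f)S^{(\varpi)}_{x_mx_{m'}}(f).$$ 5. Consequently the matrices of cross-spectra satisfy $\mathbf S_{\mathbf{yy}}(f)=\mathbf S_{\mathbf{uu}}(f)+\mathbf S_{\mathbf{dd}}(f)$ for almost every $f$. -/

import Mathlib

open MeasureTheory ProbabilityTheory
open scoped FourierTransform Convolution ComplexConjugate

noncomputable section

namespace MemPoly

/-- The odd integers in `[l, u]`. -/
def oddIcc (l u : ℕ) : Finset ℕ := (Finset.Icc l u).filter Odd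

section Processes

variable {Ω : Type*} [MeasurableSpace Ω]

/-- The processes `x 1, …, x M` are jointly circularly symmetric (complex) Gaussian: the family
`(x m t)` indexed by `(m, t)` is jointly Gaussian, and all its finite dimensional distributions
are invariant under a common rotation by `exp (i θ)`. -/
structure IsCircGaussian {M : ℕ} (x : Fin M → ℝ → Ω → ℂ) (P : Measure Ω) : Prop where
  gaussian : IsGaussianProcess (fun (p : Fin M × ℝ) (ω : Ω) => x p.1 p.2 ω) P
  circular : ∀ (θ : ℝ) (I : Finset (Fin M × ℝ)),
    P.map (fun ω => I.restrict
        (fun p : Fin M × ℝ => Complex.exp (θ * Complex.I) * x p.1 p.2 ω)) =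
      P.map (fun ω => I.restrict (fun p : Fin M × ℝ => x p.1 p.2 ω))

/-- The cross-correlation `R_{XY}(τ) = E[X(t) Y(t - τ)^*]`, evaluated at `t = 0`.
For jointly weak-sense stationary processes the value does not depend on `t`,
see `IsJointlyWSS`. -/
def crossCorr (P : Measure Ω) (X Y : ℝ → Ω → ℂ) (τ : ℝ) : ℂ :=
  ∫ ω, X 0 ω * conj (Y (0 - τ) ω) ∂P

/-- Joint weak-sense stationarity: finite second moments, constant means, and cross-correlations
`E[z_m(t) z_{m'}(t - τ)^*]` that do not depend on `t`. -/
structure IsJointlyWSS {M : ℕ} (z : Fin M → ℝ → Ω → ℂ) (P : Measure Ω) : Prop where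
  memLp : ∀ m t, MemLp (z m t) 2 P
  mean : ∀ m t, ∫ ω, z m t ω ∂P = ∫ ω, z m 0 ω ∂P
  corr : ∀ m m' t τ, ∫ ω, z m t ω * conj (z m' (t - τ) ω) ∂P = crossCorr P (z m) (z m') τ

/-- The square root of the power of a stationary process, `σ_X = (E|X(t)|²)^{1/2}`
(evaluated at `t = 0`). -/
def rms (P : Measure Ω) (X : ℝ → Ω → ℂ) : ℝ := Real.sqrt (∫ ω, ‖X 0 ω‖ ^ 2 ∂P)

end Processes

/-- `S` is the spectrum (spectral density) belonging to the correlation function `R`: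
`S` is integrable and `R(τ) = ∫ S(f) exp(2πi f τ) df` for all `τ`. In contrast to the formula
`S(f) = ∫ R(τ) exp(-2πi f τ) dτ`, this also makes sense when `R` is not integrable, e.g. for ideally
bandlimited signals. The function `S` is determined by `R` almost everywhere. -/
def IsSpectrum (R S : ℝ → ℂ) : Prop := Integrable S ∧ ∀ τ, R τ = 𝓕⁻ S τ

/-- If the classical Fourier transform of `R` exists and can be inverted, it is the spectrum. -/
theorem isSpectrum_fourier {R : ℝ → ℂ} (hc : Continuous R) (hi : Integrable R)
    (hF : Integrable (𝓕 R)) : IsSpectrum R (𝓕 R) :=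
  ⟨hF, fun τ => (congrFun (hc.fourierInv_fourier_eq hi hF) τ).symm⟩

/-- The Itô generalization of the Hermite polynomials, for odd `ϖ`. -/
def hermite (ϖ : ℕ) (z : ℂ) : ℂ :=
  ∑ i ∈ Finset.range ((ϖ - 1) / 2 + 1),
    (-1 : ℂ) ^ i * (i.factorial : ℂ) * (((ϖ + 1) / 2).choose i : ℂ) *
      (((ϖ - 1) / 2).choose i : ℂ) * (z * (‖z‖ : ℂ) ^ (ϖ - 1 - 2 * i))

/-- The kernel `a_ϖ` of the Hermite expansion of the memory polynomial of order `N` with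
kernels `b`, for an input with root mean square `σ`. -/
def hermiteKernel (N : ℕ) (b : ℕ → ℝ → ℂ) (σ : ℝ) (ϖ : ℕ) (τ : ℝ) : ℂ :=
  ∑ κ ∈ oddIcc ϖ N,
    ((((κ - ϖ) / 2).factorial * ((κ + 1) / 2).choose ((κ - ϖ) / 2) *
      ((κ - 1) / 2).choose ((κ - ϖ) / 2) : ℕ) : ℂ) * (σ : ℂ) ^ (κ - ϖ) * b κ τ

section Amplifier

variable {Ω : Type*} [MeasurableSpace Ω]

/-- The amplifier: a memory polynomial of order `N` with kernels `b`. -/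
def amplifier (N : ℕ) (b : ℕ → ℝ → ℂ) (X : ℝ → Ω → ℂ) (t : ℝ) (ω : Ω) : ℂ :=
  ∑ ϖ ∈ oddIcc 1 N, ∫ τ, b ϖ (t - τ) * (X τ ω * (‖X τ ω‖ : ℂ) ^ (ϖ - 1))

/-- The integrand `a_ϖ(t - τ) σ^ϖ H_ϖ(X(τ) / σ)` of the Hermite expansion. -/
def hermiteIntegrand (P : Measure Ω) (N : ℕ) (b : ℕ → ℝ → ℂ) (X : ℝ → Ω → ℂ) (ϖ : ℕ)
    (t : ℝ) (ω : Ω) (τ : ℝ) : ℂ :=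
  hermiteKernel N b (rms P X) ϖ (t - τ) *
    ((rms P X : ℂ) ^ ϖ * hermite ϖ (X τ ω / (rms P X : ℂ)))

/-- The linearly amplified signal `u`. -/
def linearPart (P : Measure Ω) (N : ℕ) (b : ℕ → ℝ → ℂ) (X : ℝ → Ω → ℂ) (t : ℝ) (ω : Ω) : ℂ :=
  ∫ τ, hermiteKernel N b (rms P X) 1 (t - τ) * X τ ω

/-- The distortion `d`. -/
def distortion (P : Measure Ω) (N : ℕ) (b : ℕ → ℝ → ℂ) (X : ℝ → Ω → ℂ) (t : ℝ) (ω : Ω) : ℂ :=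
  ∑ ϖ ∈ oddIcc 3 N, ∫ τ, hermiteIntegrand P N b X ϖ t ω τ

/-- The transfer function `A_ϖ`, the Fourier transform of the kernel `a_ϖ`. -/
def transfer (P : Measure Ω) (N : ℕ) (b : ℕ → ℝ → ℂ) (X : ℝ → Ω → ℂ) (ϖ : ℕ) : ℝ → ℂ :=
  𝓕 (hermiteKernel N b (rms P X) ϖ)

end Amplifier

/-- `f ⋆ g ⋆ ⋯ ⋆ g` with `n` factors `g` (convolution over `ℝ`). -/
def iterConv (f g : ℝ → ℂ) : ℕ → ℝ → ℂ
  | 0 => f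
  | n + 1 => iterConv f g n ⋆[ContinuousLinearMap.mul ℂ ℂ, volume] g

/-- The constant `((ϖ + 1) / 2)! ((ϖ - 1) / 2)!`, for odd `ϖ`. -/
def termConst (ϖ : ℕ) : ℂ := (((ϖ + 1) / 2).factorial : ℂ) * (((ϖ - 1) / 2).factorial : ℂ)

/-- The individual cross-correlation `R^{(ϖ)}` of degree `ϖ`. -/
def termCorr (ϖ : ℕ) (R : ℝ → ℂ) (τ : ℝ) : ℂ := termConst ϖ * (R τ * (‖R τ‖ : ℂ) ^ (ϖ - 1))

/-- The individual cross-spectrum `S^{(ϖ)}` of degree `ϖ` (odd): the constant times the convolution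
of `(ϖ + 1) / 2` factors `S(φ)` and `(ϖ - 1) / 2` factors `S(-φ)^*`. -/
def termSpec (ϖ : ℕ) (S : ℝ → ℂ) (f : ℝ) : ℂ :=
  termConst ϖ *
    iterConv (iterConv S S ((ϖ - 1) / 2)) (fun φ => conj (S (-φ))) ((ϖ - 1) / 2) f

end MemPoly

end

/-! Expand the nonlinearity in polynomials that are orthogonal for the Gaussian law. With variance
`s`, the Itô-Hermite polynomials `itoHermite s a b` are the monomials `z ^ a * conj z ^ b` with all
self-contractions removed. For a circularly symmetric Gaussian pair `Z, W` with `r = E[Z W*]`,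
polynomials of different odd degrees are uncorrelated (`integral_itoHermite_mul_conj_of_ne`), and
those of degree `2n+1` have correlation `(n+1)! n! r |r|^(2n)`
(`integral_itoHermite_mul_conj_self`). Both follow from Gaussian integration by parts for monomials
(`mixedMoment_stein`).

Inverting the expansion writes `z |z|^(κ-1)` as a combination of Hermite polynomials of odd degree
at most `κ`. Collecting the terms of each degree `ϖ` produces the kernels `a_ϖ`
(`sum_hermiteKernel_mul`), so `y` is almost surely a sum of components, each a filtered Hermite
signal.

By Fubini, the second-order statistics of filtered signals are double integrals of those of the
Hermite signals. Hence components of different degree are uncorrelated, and those of degree `ϖ` have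
spectrum `A_ϖ A'_ϖ* S^(ϖ)`: powers of `R` become convolutions of `S`, conjugation becomes `S(-f)*`,
and filters become factors (`isOrthFamily_component`). The signals `y`, `u`, `d` are the sums over
all degrees, over degree 1 and over degrees at least 3, so stationarity, uncorrelatedness and
spectra follow at once from `IsOrthFamily`. The partition for arbitrary versions of the spectra uses
uniqueness (`IsSpectrum.ae_eq`). -/

noncomputable section

namespace MemPoly

/-! ### Moments and independence of circularly symmetric Gaussian pairs -/

section GaussianMoments

/-- Each side is a Gamma integral, and the ratio comes from `Γ(s + 1) = s Γ(s)`. -/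
lemma integral_pow_mul_exp_neg_mul_sq (b : ℝ) (hb : 0 < b) (a : ℕ) :
    ∫ x : ℝ, x ^ (2 * (a + 1)) * Real.exp (-b * x ^ 2) =
      (2 * a + 1) / (2 * b) * ∫ x : ℝ, x ^ (2 * a) * Real.exp (-b * x ^ 2) := by
  have key : ∀ k : ℕ, ∫ x : ℝ, x ^ (2 * k) * Real.exp (-b * x ^ 2) =
      2 * (b ^ (-((2 * k : ℝ) + 1) / 2) * (1 / 2) * Real.Gamma (((2 * k : ℝ) + 1) / 2)) := by
    intro k
    have h1 := integral_comp_abs (f := fun x : ℝ => x ^ (2 * k) * Real.exp (-b * x ^ 2))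
    simp only [pow_mul, sq_abs] at h1
    simp only [pow_mul]
    rw [h1, ← integral_rpow_mul_exp_neg_mul_rpow (by norm_num)
      (by linarith [Nat.cast_nonneg (α := ℝ) k]) hb]
    congr 1
    refine setIntegral_congr_fun measurableSet_Ioi fun x _ => ?_
    have : (2 * k : ℝ) = ((2 * k : ℕ) : ℝ) := by push_cast; ring
    simp only [this, Real.rpow_natCast, Real.rpow_two, pow_mul]
  rw [key, key]
  have h2 : ((2 * ((a + 1 : ℕ) : ℝ)) + 1) / 2 = ((2 * a : ℝ) + 1) / 2 + 1 := by push_cast; ring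
  have h3 : -((2 * ((a + 1 : ℕ) : ℝ)) + 1) / 2 = -((2 * a : ℝ) + 1) / 2 - 1 := by push_cast; ring
  have h4 : ((2 * a : ℝ) + 1) / 2 ≠ 0 := by positivity
  rw [h2, h3, Real.Gamma_add_one h4, Real.rpow_sub_one hb.ne']
  field_simp

lemma integral_pow_two_mul_gaussianReal (v : NNReal) (a : ℕ) :
    (a.factorial * 2 ^ a : ℝ) * ∫ x, x ^ (2 * a) ∂gaussianReal 0 v =
      (2 * a).factorial * (v : ℝ) ^ a := by
  rcases eq_or_ne v 0 with rfl | hv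
  · rcases a with _ | a <;> simp
  have hv' : (0 : ℝ) < v := by positivity
  induction a with
  | zero => simp
  | succ a ih =>
    have h0 : ∀ k : ℕ, ∫ x, x ^ (2 * k) ∂gaussianReal 0 v =
        (√(2 * Real.pi * v))⁻¹ * ∫ x : ℝ, x ^ (2 * k) * Real.exp (-(1 / (2 * v : ℝ)) * x ^ 2) := by
      intro k
      rw [integral_gaussianReal_eq_integral_smul hv, ← integral_const_mul]
      congr 1 with x
      simp only [gaussianPDFReal, sub_zero, smul_eq_mul]
      rw [show -x ^ 2 / (2 * (v : ℝ)) = -(1 / (2 * v : ℝ)) * x ^ 2 by ring]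
      ring
    have h1 : ∫ x, x ^ (2 * (a + 1)) ∂gaussianReal 0 v =
        (2 * a + 1) * v * ∫ x, x ^ (2 * a) ∂gaussianReal 0 v := by
      rw [h0, h0, integral_pow_mul_exp_neg_mul_sq _ (by positivity)]
      field_simp
    rw [h1, show 2 * (a + 1) = 2 * a + 1 + 1 by ring]
    simp only [Nat.factorial_succ, pow_succ]
    push_cast
    linear_combination (2 * (a + 1) * (2 * a + 1) * v : ℝ) * ih

variable {Ω : Type*} [MeasurableSpace Ω] {P : Measure Ω}

/-- All absolute moments of `f` are finite. -/
def AllMoments (f : Ω → ℂ) (P : Measure Ω) : Prop := ∀ p : ENNReal, p ≠ ⊤ → MemLp f p P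

namespace AllMoments

variable {f g : Ω → ℂ}

lemma integrable (hf : AllMoments f P) : Integrable f P :=
  memLp_one_iff_integrable.1 (hf 1 (by simp))

lemma mul (hf : AllMoments f P) (hg : AllMoments g P) : AllMoments (fun ω => f ω * g ω) P := by
  intro p hp
  have : ENNReal.HolderTriple (2 * p) (2 * p) p := by
    constructor
    rw [ENNReal.mul_inv (by simp) (by simp), ← add_mul, ENNReal.inv_two_add_inv_two, one_mul]
  exact MemLp.mul (p := 2 * p) (q := 2 * p) (hg _ (ENNReal.mul_ne_top (by simp) hp))
    (hf _ (ENNReal.mul_ne_top (by simp) hp))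

lemma star (hf : AllMoments f P) : AllMoments (fun ω => conj (f ω)) P :=
  fun p hp => (hf p hp).star

lemma const [IsFiniteMeasure P] (c : ℂ) : AllMoments (fun _ : Ω => c) P :=
  fun _ _ => memLp_const c

lemma add (hf : AllMoments f P) (hg : AllMoments g P) : AllMoments (fun ω => f ω + g ω) P :=
  fun p hp => (hf p hp).add (hg p hp)

lemma const_mul (hf : AllMoments f P) (c : ℂ) : AllMoments (fun ω => c * f ω) P :=
  fun p hp => (hf p hp).const_mul c

lemma pow [IsFiniteMeasure P] (hf : AllMoments f P) (n : ℕ) :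
    AllMoments (fun ω => f ω ^ n) P := by
  induction n with
  | zero => simpa using const 1
  | succ n ih => simpa only [pow_succ] using ih.mul hf

lemma sum [IsFiniteMeasure P] {ι : Type*} (s : Finset ι) {F : ι → Ω → ℂ}
    (hF : ∀ i ∈ s, AllMoments (F i) P) : AllMoments (fun ω => ∑ i ∈ s, F i ω) P :=
  fun p hp => memLp_finsetSum s fun i hi => hF i hi p hp

end AllMoments

/-- A jointly Gaussian pair of complex random variables whose joint law is invariant under
common rotations. -/
structure CircPair (P : Measure Ω) (Z W : Ω → ℂ) : Prop where
  gaussian : HasGaussianLaw (fun ω => (Z ω, W ω)) P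
  circular : ∀ θ : ℝ, P.map (fun ω =>
      (Complex.exp (θ * Complex.I) * Z ω, Complex.exp (θ * Complex.I) * W ω)) =
    P.map (fun ω => (Z ω, W ω))

/-- The mixed moment `E[Z^a Z*^b W^c W*^d]`. -/
def mixedMoment (P : Measure Ω) (Z W : Ω → ℂ) (a b c d : ℕ) : ℂ :=
  ∫ ω, Z ω ^ a * conj (Z ω) ^ b * (W ω ^ c * conj (W ω) ^ d) ∂P

namespace CircPair

variable {Z W : Ω → ℂ}

lemma isProb (h : CircPair P Z W) : IsProbabilityMeasure P := h.gaussian.isProbabilityMeasure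

lemma allMoments_fst (h : CircPair P Z W) : AllMoments Z P :=
  fun _ hp => h.gaussian.fst.memLp hp

lemma allMoments_snd (h : CircPair P Z W) : AllMoments W P :=
  fun _ hp => h.gaussian.snd.memLp hp

/-- Complex linear maps commute with the common rotation; a merely real linear map could destroy
circularity. -/
lemma map_lin (h : CircPair P Z W) (α β γ δ : ℂ) :
    CircPair P (fun ω => α * Z ω + β * W ω) (fun ω => γ * Z ω + δ * W ω) := by
  let L₁ : ℂ × ℂ →L[ℂ] ℂ := α • .fst ℂ ℂ ℂ + β • .snd ℂ ℂ ℂ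
  let L₂ : ℂ × ℂ →L[ℂ] ℂ := γ • .fst ℂ ℂ ℂ + δ • .snd ℂ ℂ ℂ
  let L : ℂ × ℂ →L[ℂ] ℂ × ℂ := L₁.prod L₂
  refine ⟨h.gaussian.map_fun (L.restrictScalars ℝ), fun θ => ?_⟩
  have hm := h.gaussian.aemeasurable
  have := congrArg (Measure.map L) (h.circular θ)
  rw [AEMeasurable.map_map_of_aemeasurable (by fun_prop)
      ((hm.fst.const_mul _).prodMk (hm.snd.const_mul _)),
    AEMeasurable.map_map_of_aemeasurable (by fun_prop) hm] at this
  convert this using 2 <;> ext ω <;> simp [L, L₁, L₂] <;> ring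

lemma swap (h : CircPair P Z W) : CircPair P W Z := by
  simpa using h.map_lin 0 1 1 0

lemma allMoments_mixed (h : CircPair P Z W) (a b c d : ℕ) :
    AllMoments (fun ω => Z ω ^ a * conj (Z ω) ^ b * (W ω ^ c * conj (W ω) ^ d)) P := by
  have := h.isProb
  exact ((h.allMoments_fst.pow a).mul (h.allMoments_fst.star.pow b)).mul
    ((h.allMoments_snd.pow c).mul (h.allMoments_snd.star.pow d))

/-- A rotation by `θ` leaves the law unchanged but multiplies the integrand by `exp(i k θ)` with `k
= a + c - b - d ≠ 0`. -/
lemma mixedMoment_eq_zero (h : CircPair P Z W) {a b c d : ℕ} (hne : a + c ≠ b + d) :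
    mixedMoment P Z W a b c d = 0 := by
  let F : ℂ × ℂ → ℂ := fun p => p.1 ^ a * conj p.1 ^ b * (p.2 ^ c * conj p.2 ^ d)
  have hF : Continuous F := by fun_prop
  set k : ℝ := (a + c : ℝ) - (b + d) with hk
  have hk0 : k ≠ 0 := by
    rw [hk, sub_ne_zero]
    exact_mod_cast hne
  -- With the angle `π / k` that factor is `-1`, so the moment equals its own negative.
  set e : ℂ := Complex.exp ((Real.pi / k : ℝ) * Complex.I) with he
  have hm := h.gaussian.aemeasurable
  have h1 : ∫ p, F p ∂(P.map (fun ω => (e * Z ω, e * W ω))) =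
      ∫ p, F p ∂(P.map (fun ω => (Z ω, W ω))) := by rw [h.circular]
  rw [integral_map ((hm.fst.const_mul _).prodMk (hm.snd.const_mul _)) hF.aestronglyMeasurable,
    integral_map hm hF.aestronglyMeasurable] at h1
  have h2 : ∀ ω, F (e * Z ω, e * W ω) = (e ^ (a + c) * conj e ^ (b + d)) * F (Z ω, W ω) := by
    intro ω
    simp only [F, map_mul]
    ring
  have h3 : e ^ (a + c) * conj e ^ (b + d) = -1 := by
    rw [he, ← Complex.exp_conj, ← Complex.exp_nat_mul, ← Complex.exp_nat_mul, ← Complex.exp_add,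
      ← Complex.exp_pi_mul_I]
    congr 1
    simp only [map_mul, Complex.conj_ofReal, Complex.conj_I]
    have : (k : ℂ) ≠ 0 := by exact_mod_cast hk0
    push_cast
    field_simp
    rw [hk]
    push_cast
    ring
  simp only [h2, h3, neg_mul, one_mul, integral_neg] at h1
  change ∫ ω, F (Z ω, W ω) ∂P = 0
  have h4 : (2 : ℂ) * ∫ ω, F (Z ω, W ω) ∂P = 0 := by linear_combination -h1
  simpa using h4

lemma integral_fst (h : CircPair P Z W) : ∫ ω, Z ω ∂P = 0 := by
  simpa [mixedMoment] using h.mixedMoment_eq_zero (a := 1) (b := 0) (c := 0) (d := 0) (by simp)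

/-- Expanding `((Z + Z*) / 2) ^ (2a)` binomially, circularity kills every term except the balanced
one. This ties `E|Z|^(2a)` to the moments of a real Gaussian variable. -/
lemma integral_re_pow (h : CircPair P Z W) (a : ℕ) :
    ((∫ ω, (Z ω).re ^ (2 * a) ∂P : ℝ) : ℂ) =
      (4 ^ a : ℂ)⁻¹ * ((2 * a).choose a * mixedMoment P Z W a a 0 0) := by
  have h1 : ∀ ω, (((Z ω).re ^ (2 * a) : ℝ) : ℂ) = (4 ^ a : ℂ)⁻¹ *
      ∑ k ∈ Finset.range (2 * a + 1), ((2 * a).choose k : ℂ) *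
        (Z ω ^ k * conj (Z ω) ^ (2 * a - k) * (W ω ^ 0 * conj (W ω) ^ 0)) := by
    intro ω
    rw [Complex.ofReal_pow, Complex.re_eq_add_conj, div_pow, add_pow, pow_mul (2 : ℂ)]
    norm_num
    rw [div_eq_inv_mul]
    congr 1
    exact Finset.sum_congr rfl fun k _ => by ring
  rw [← integral_complex_ofReal]
  simp only [h1]
  rw [integral_const_mul, integral_finsetSum _ fun k _ =>
    ((h.allMoments_mixed _ _ _ _).const_mul _).integrable]
  congr 1
  rw [Finset.sum_eq_single a]
  · rw [integral_const_mul, mixedMoment, show 2 * a - a = a by omega]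
  · intro k hk hka
    have : mixedMoment P Z W k (2 * a - k) 0 0 = 0 :=
      h.mixedMoment_eq_zero (by rw [Finset.mem_range] at hk; omega)
    rw [mixedMoment] at this
    rw [integral_const_mul, this, mul_zero]
  · intro ha
    simp at ha
    omega

lemma mixedMoment_one_one (P : Measure Ω) (Z W : Ω → ℂ) :
    mixedMoment P Z W 1 1 0 0 = (∫ ω, ‖Z ω‖ ^ 2 ∂P : ℝ) := by
  rw [mixedMoment, ← integral_complex_ofReal]
  congr 1 with ω
  simp [Complex.mul_conj, Complex.normSq_eq_norm_sq]

/-- The real part is a centered real Gaussian variable of variance `s / 2`, whose moments are known;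
`integral_re_pow` is then solved for the complex moment. -/
lemma mixedMoment_self (h : CircPair P Z W) (a : ℕ) :
    mixedMoment P Z W a a 0 0 = a.factorial * ((∫ ω, ‖Z ω‖ ^ 2 ∂P : ℝ) : ℂ) ^ a := by
  have := h.isProb
  have hg : HasGaussianLaw (fun ω => (Z ω).re) P := h.gaussian.fst.map_fun Complex.reCLM
  set s : ℝ := ∫ ω, ‖Z ω‖ ^ 2 ∂P with hs
  have hmean : ∫ ω, (Z ω).re ∂P = 0 := by
    have := integral_re h.allMoments_fst.integrable
    simp only [RCLike.re_to_complex] at this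
    rw [this, h.integral_fst, Complex.zero_re]
  have hsq : ∫ ω, (Z ω).re ^ 2 ∂P = s / 2 := by
    have h1 := h.integral_re_pow 1
    rw [mixedMoment_one_one, ← hs] at h1
    norm_num at h1
    have h2 : ((∫ ω, (Z ω).re ^ 2 ∂P : ℝ) : ℂ) = ((s / 2 : ℝ) : ℂ) := by
      rw [h1]; push_cast; ring
    exact_mod_cast h2
  have hvar : Var[fun ω => (Z ω).re; P] = s / 2 := by
    rw [variance_of_integral_eq_zero hg.aemeasurable hmean, hsq]
  have hs0 : 0 ≤ s := integral_nonneg fun _ => by positivity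
  have hmom : (a.factorial * 2 ^ a : ℝ) * ∫ ω, (Z ω).re ^ (2 * a) ∂P =
      (2 * a).factorial * (s / 2) ^ a := by
    have h1 := integral_pow_two_mul_gaussianReal (s / 2).toNNReal a
    have h2 := hg.map_eq_gaussianReal
    rw [hmean, hvar] at h2
    rw [← h2, integral_map hg.aemeasurable (by fun_prop), Real.coe_toNNReal _ (by positivity)] at h1
    exact h1
  have h3 := h.integral_re_pow a
  have h4 : ((a.factorial * 2 ^ a : ℝ) : ℂ) * ((∫ ω, (Z ω).re ^ (2 * a) ∂P : ℝ) : ℂ) =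
      (((2 * a).factorial * (s / 2) ^ a : ℝ) : ℂ) := by
    rw [← hmom]; push_cast; ring
  rw [h3] at h4
  have h5 : (((2 * a).choose a : ℕ) : ℂ) * (a.factorial : ℂ) * (a.factorial : ℂ) =
      ((2 * a).factorial : ℂ) := by
    have := Nat.choose_mul_factorial_mul_factorial (n := 2 * a) (k := a) (by omega)
    rw [show 2 * a - a = a by omega] at this
    exact_mod_cast this
  have h6 : ((2 * a).factorial : ℂ) ≠ 0 := by exact_mod_cast Nat.factorial_ne_zero _
  have h7 : (a.factorial : ℂ) ≠ 0 := by exact_mod_cast Nat.factorial_ne_zero _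
  apply mul_left_cancel₀ h6
  have h8 : (4 : ℂ) ^ a = 2 ^ a * 2 ^ a := by rw [← mul_pow]; norm_num
  rw [h8] at h4
  push_cast at h4
  rw [div_pow] at h4
  field_simp at h4
  linear_combination (a.factorial : ℂ) * h4 - mixedMoment P Z W a a 0 0 * h5

/-- For jointly Gaussian variables it suffices that all real covariances vanish. These are
combinations of `E[Z W]`, zero by circularity, and `E[Z W*]`, zero by assumption. -/
lemma indepFun (h : CircPair P Z W) (h0 : ∫ ω, Z ω * conj (W ω) ∂P = 0) : Z ⟂ᵢ[P] W := by
  have := h.isProb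
  have hZ := h.allMoments_fst
  have hW := h.allMoments_snd
  have h1 : ∫ ω, Z ω * W ω ∂P = 0 := by
    simpa [mixedMoment] using h.mixedMoment_eq_zero (a := 1) (b := 0) (c := 1) (d := 0) (by simp)
  have hin : ∀ x z : ℂ, inner ℝ x z = (conj x * z).re := fun x z => by
    rw [mul_comm]; rfl
  refine h.gaussian.indepFun_of_covariance_inner fun x y => ?_
  simp only [hin]
  have hmX : ∫ ω, (conj x * Z ω).re ∂P = 0 := by
    have := integral_re (hZ.const_mul (conj x)).integrable
    simp only [RCLike.re_to_complex] at this
    rw [this, integral_const_mul, h.integral_fst, mul_zero, Complex.zero_re]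
  rw [covariance_eq_sub (X := fun ω => (conj x * Z ω).re) (Y := fun ω => (conj y * W ω).re)
    ((hZ.const_mul (conj x)) 2 (by simp)).re
    ((hW.const_mul (conj y)) 2 (by simp)).re, hmX, zero_mul, sub_zero]
  -- This is `Re p · Re q = Re(p q + p q*) / 2`.
  have h2 : ∀ ω, ((fun ω => (conj x * Z ω).re) * fun ω => (conj y * W ω).re) ω =
      ((conj x * conj y / 2) * (Z ω * W ω) + (conj x * y / 2) * (Z ω * conj (W ω))).re := by
    intro ω
    simp [Complex.add_re, Complex.mul_re, Complex.mul_im]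
    ring
  simp only [h2]
  have hi1 := ((hZ.mul hW).const_mul (conj x * conj y / 2)).integrable
  have hi2 := ((hZ.mul hW.star).const_mul (conj x * y / 2)).integrable
  have := integral_re (hi1.add hi2)
  simp only [RCLike.re_to_complex, Pi.add_apply] at this
  rw [this, integral_add hi1 hi2, integral_const_mul, integral_const_mul, h0, h1]
  simp

end CircPair

end GaussianMoments

/-! ### Gaussian integration by parts for monomials -/

section Stein

variable {Ω : Type*} [MeasurableSpace Ω] {P : Measure Ω}

namespace CircPair

variable {Z W : Ω → ℂ}

/-- The truncated `a - 1` is harmless at `a = 0`, where the prefactor `a` vanishes. The same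
convention is used in all the integration by parts formulas below. -/
lemma mixedMoment_stein_self (h : CircPair P Z W) (a b : ℕ) :
    mixedMoment P Z W a (b + 1) 0 0 =
      a * (∫ ω, ‖Z ω‖ ^ 2 ∂P : ℝ) * mixedMoment P Z W (a - 1) b 0 0 := by
  rcases a with _ | a
  · rw [h.mixedMoment_eq_zero (by omega)]
    simp
  rw [Nat.add_sub_cancel]
  rcases eq_or_ne a b with rfl | hab
  · rw [h.mixedMoment_self, h.mixedMoment_self, Nat.factorial_succ]
    push_cast
    ring
  · rw [h.mixedMoment_eq_zero (by omega), h.mixedMoment_eq_zero (by omega), mul_zero]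

/-- The mixed moment `E[Z^a Z*^b V^e V*^f W^c W*^d]` for `W = V + ρ Z`. -/
def shearMoment (P : Measure Ω) (Z V : Ω → ℂ) (ρ : ℂ) (a b e f c d : ℕ) : ℂ :=
  ∫ ω, Z ω ^ a * conj (Z ω) ^ b * (V ω ^ e * conj (V ω) ^ f) *
    ((V ω + ρ * Z ω) ^ c * conj (V ω + ρ * Z ω) ^ d) ∂P

variable {V : Ω → ℂ}

lemma allMoments_shear (h : CircPair P Z V) (ρ : ℂ) (a b e f c d : ℕ) :
    AllMoments (fun ω => Z ω ^ a * conj (Z ω) ^ b * (V ω ^ e * conj (V ω) ^ f) *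
      ((V ω + ρ * Z ω) ^ c * conj (V ω + ρ * Z ω) ^ d)) P := by
  have := h.isProb
  have h1 := h.allMoments_snd.add (h.allMoments_fst.const_mul ρ)
  exact (h.allMoments_mixed a b e f).mul ((h1.pow c).mul (h1.star.pow d))

lemma shearMoment_succ_left (h : CircPair P Z V) (ρ : ℂ) (a b e f c d : ℕ) :
    shearMoment P Z V ρ a b e f (c + 1) d =
      shearMoment P Z V ρ a b (e + 1) f c d + ρ * shearMoment P Z V ρ (a + 1) b e f c d := by
  simp only [shearMoment]
  rw [← integral_const_mul, ← integral_add (h.allMoments_shear ρ _ _ _ _ _ _).integrable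
    ((h.allMoments_shear ρ _ _ _ _ _ _).const_mul ρ).integrable]
  congr 1 with ω
  ring

lemma shearMoment_succ_right (h : CircPair P Z V) (ρ : ℂ) (a b e f c d : ℕ) :
    shearMoment P Z V ρ a b e f c (d + 1) = shearMoment P Z V ρ a b e (f + 1) c d +
      conj ρ * shearMoment P Z V ρ a (b + 1) e f c d := by
  simp only [shearMoment]
  rw [← integral_const_mul, ← integral_add (h.allMoments_shear ρ _ _ _ _ _ _).integrable
    ((h.allMoments_shear ρ _ _ _ _ _ _).const_mul (conj ρ)).integrable]
  congr 1 with ω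
  simp only [map_add, map_mul]
  ring

/-- One factor `Z*` acts as `s ∂/∂Z`, where `Z` occurs in `Z ^ a` and in `(V + ρ Z) ^ c`, while
conjugated factors count as constants. Without shear factors, independence splits off the moment of
`V`. Splitting off a factor `V + ρ Z` or its conjugate shifts the other exponents, so the induction
must keep `a b e f` general. -/
lemma shearMoment_stein (h : CircPair P Z V) (hind : Z ⟂ᵢ[P] V) (ρ : ℂ) (c d : ℕ) :
    ∀ a b e f : ℕ, shearMoment P Z V ρ a (b + 1) e f c d =
      a * (∫ ω, ‖Z ω‖ ^ 2 ∂P : ℝ) * shearMoment P Z V ρ (a - 1) b e f c d +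
      c * ((∫ ω, ‖Z ω‖ ^ 2 ∂P : ℝ) * ρ) * shearMoment P Z V ρ a b e f (c - 1) d := by
  have := h.isProb
  set s : ℂ := ((∫ ω, ‖Z ω‖ ^ 2 ∂P : ℝ) : ℂ) with hs
  have hbase : ∀ a b e f : ℕ, shearMoment P Z V ρ a b e f 0 0 =
      mixedMoment P Z V a b 0 0 * ∫ ω, V ω ^ e * conj (V ω) ^ f ∂P := by
    intro a b e f
    have h1 := hind.comp (φ := fun z : ℂ => z ^ a * conj z ^ b)
      (ψ := fun z : ℂ => z ^ e * conj z ^ f) (by fun_prop) (by fun_prop)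
    have h2 := h1.integral_mul_eq_mul_integral
      ((h.allMoments_fst.pow a).mul (h.allMoments_fst.star.pow b)).integrable.aestronglyMeasurable
      ((h.allMoments_snd.pow e).mul (h.allMoments_snd.star.pow f)).integrable.aestronglyMeasurable
    simpa [shearMoment, mixedMoment] using h2
  induction d with
  | zero =>
    induction c with
    | zero =>
      intro a b e f
      simp only [hbase, h.mixedMoment_stein_self, ← hs]
      simp
      ring
    | succ c ih =>
      intro a b e f
      rw [h.shearMoment_succ_left, ih, ih, Nat.add_sub_cancel]
      have h1 : (a : ℂ) * s * shearMoment P Z V ρ (a - 1) b e f (c + 1) 0 =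
          a * s * (shearMoment P Z V ρ (a - 1) b (e + 1) f c 0 +
            ρ * shearMoment P Z V ρ a b e f c 0) := by
        rcases a with _ | a
        · simp
        · rw [h.shearMoment_succ_left, Nat.add_sub_cancel]
      have h2 : (c : ℂ) * shearMoment P Z V ρ a b e f c 0 =
          c * (shearMoment P Z V ρ a b (e + 1) f (c - 1) 0 +
            ρ * shearMoment P Z V ρ (a + 1) b e f (c - 1) 0) := by
        rcases c with _ | c
        · simp
        · rw [h.shearMoment_succ_left, Nat.add_sub_cancel]
      rw [h1, Nat.add_sub_cancel]
      push_cast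
      linear_combination (-(s * ρ)) * h2
  | succ d ih =>
    intro a b e f
    rw [h.shearMoment_succ_right, ih, ih, h.shearMoment_succ_right, h.shearMoment_succ_right]
    ring

/-- Gaussian integration by parts for the monomials of a circularly symmetric pair. -/
lemma mixedMoment_stein (h : CircPair P Z W) (a b c d : ℕ) :
    mixedMoment P Z W a (b + 1) c d =
      a * (∫ ω, ‖Z ω‖ ^ 2 ∂P : ℝ) * mixedMoment P Z W (a - 1) b c d +
      c * conj (∫ ω, Z ω * conj (W ω) ∂P) * mixedMoment P Z W a b (c - 1) d := by
  have := h.isProb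
  set s : ℝ := ∫ ω, ‖Z ω‖ ^ 2 ∂P with hs
  set r : ℂ := ∫ ω, Z ω * conj (W ω) ∂P with hr
  have hss : ∫ ω, Z ω * conj (Z ω) ∂P = s := by
    have := mixedMoment_one_one P Z W
    simpa [mixedMoment] using this
  have hr0 : s = 0 → r = 0 := by
    intro h0
    rw [hs, integral_eq_zero_iff_of_nonneg (fun _ => by positivity)
      ((h.allMoments_fst 2 (by simp)).integrable_norm_pow (by simp))] at h0
    rw [hr]
    apply integral_eq_zero_of_ae
    filter_upwards [h0] with ω hω
    have : Z ω = 0 := by simpa using hω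
    simp [this]
  -- The regression coefficient of `W` on `Z`: the residual `W - ρ Z` is uncorrelated with `Z`,
  -- hence independent of it. If `s = 0`, then `ρ = 0` by the convention for division, and `r = 0`
  -- keeps `s ρ = r*` valid.
  set ρ : ℂ := conj r / s with hρ
  have hsρ : s * ρ = conj r := by
    rcases eq_or_ne s 0 with h0 | h0
    · simp [h0, hr0 h0]
    · have : (s : ℂ) ≠ 0 := by exact_mod_cast h0
      rw [hρ]; field_simp
  have hV : CircPair P Z (fun ω => W ω - ρ * Z ω) := by
    have := h.map_lin 1 0 (-ρ) 1
    convert this using 2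
    · simp
    · ring
  have hcov : ∫ ω, Z ω * conj (W ω - ρ * Z ω) ∂P = 0 := by
    have h1 : ∀ ω, Z ω * conj (W ω - ρ * Z ω) =
        Z ω * conj (W ω) - conj ρ * (Z ω * conj (Z ω)) := by
      intro ω
      simp only [map_sub, map_mul]
      ring
    simp only [h1]
    rw [integral_sub (h.allMoments_fst.mul h.allMoments_snd.star).integrable
      ((h.allMoments_fst.mul h.allMoments_fst.star).const_mul _).integrable, integral_const_mul,
      hss, ← hr]
    have := congrArg conj hsρ
    simp only [map_mul, Complex.conj_ofReal, Complex.conj_conj] at this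
    linear_combination -this
  have hconv : ∀ a b c d : ℕ, mixedMoment P Z W a b c d =
      shearMoment P Z (fun ω => W ω - ρ * Z ω) ρ a b 0 0 c d := by
    intro a b c d
    simp [mixedMoment, shearMoment]
  rw [hconv, hconv, hconv, hV.shearMoment_stein (hV.indepFun hcov), hsρ]

lemma mixedMoment_conj (P : Measure Ω) (Z W : Ω → ℂ) (a b c d : ℕ) :
    conj (mixedMoment P Z W a b c d) = mixedMoment P Z W b a d c := by
  rw [mixedMoment, mixedMoment, ← integral_conj]
  congr 1 with ω
  simp only [map_mul, map_pow, Complex.conj_conj]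
  ring

/-- Without factors `Z*`, each `Z` must be contracted with one of the `d` factors `W*`; the falling
factorial counts the choices. -/
lemma mixedMoment_pow_left (h : CircPair P Z W) (a c d : ℕ) :
    mixedMoment P Z W a 0 c d =
      (∫ ω, Z ω * conj (W ω) ∂P) ^ a * d.descFactorial a * mixedMoment P Z W 0 0 c (d - a) := by
  induction a generalizing d with
  | zero => simp
  | succ a ih =>
    have h1 := congrArg conj (h.mixedMoment_stein 0 a d c)
    simp only [mixedMoment_conj, map_mul, Complex.conj_conj, Complex.conj_natCast,
      Nat.cast_zero, zero_mul, zero_add] at h1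
    rw [h1, ih]
    rcases d with _ | d
    · simp
    · rw [Nat.succ_descFactorial_succ, Nat.add_sub_cancel, Nat.add_sub_add_right]
      push_cast
      ring

end CircPair

end Stein

/-! ### Algebra of the Itô-Hermite polynomials -/

section Hermite

/-- The Itô-Hermite polynomials with variance `s`. -/
def itoHermite (s : ℂ) : ℕ → ℕ → ℂ → ℂ
  | a, 0, z => z ^ a
  | a, b + 1, z => conj z * itoHermite s a b z - s * a * itoHermite s (a - 1) b z

/-- The coefficients obey the defining recurrence by Pascal's rule in `b` together with `a C(a-1, i)
= (i+1) C(a, i+1)`. -/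
lemma itoHermite_eq_sum (s : ℂ) (a b : ℕ) (z : ℂ) :
    itoHermite s a b z = ∑ i ∈ Finset.range (b + 1), (-1 : ℂ) ^ i * (i.factorial : ℂ) *
      (a.choose i : ℂ) * (b.choose i : ℂ) * s ^ i * (z ^ (a - i) * conj z ^ (b - i)) := by
  induction b generalizing a with
  | zero => simp [itoHermite]
  | succ b ih =>
    rw [itoHermite, ih, ih, Finset.sum_range_succ' _ (b + 1)]
    have hC : ∀ i, (a : ℂ) * ((a - 1).choose i : ℂ) = (i + 1) * (a.choose (i + 1) : ℂ) := by
      intro i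
      rcases a with _ | a
      · simp
      · have := Nat.add_one_mul_choose_eq a i
        rw [Nat.add_sub_cancel, mul_comm ((i : ℂ) + 1)]
        exact_mod_cast this
    have h1 : ∑ i ∈ Finset.range (b + 1), (-1 : ℂ) ^ i * (i.factorial : ℂ) *
        (a.choose i : ℂ) * (b.choose i : ℂ) * s ^ i * (z ^ (a - i) * conj z ^ (b - i)) =
        (∑ i ∈ Finset.range (b + 1), (-1 : ℂ) ^ (i + 1) * ((i + 1).factorial : ℂ) *
        (a.choose (i + 1) : ℂ) * (b.choose (i + 1) : ℂ) * s ^ (i + 1) *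
          (z ^ (a - (i + 1)) * conj z ^ (b - (i + 1)))) + z ^ a * conj z ^ b := by
      rw [Finset.sum_range_succ' _ b, Finset.sum_range_succ _ b]
      simp
    rw [h1, mul_add, Finset.mul_sum, Finset.mul_sum, add_sub_right_comm, ← Finset.sum_sub_distrib]
    congr 1
    · refine Finset.sum_congr rfl fun i hi => ?_
      have hp : (b.choose (i + 1) : ℂ) * (conj z * conj z ^ (b - (i + 1))) =
          b.choose (i + 1) * conj z ^ (b - i) := by
        rcases lt_or_ge i b with hib | hib
        · rw [← pow_succ', show b - (i + 1) + 1 = b - i by omega]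
        · rw [Nat.choose_eq_zero_of_lt (by omega)]; simp
      rw [Nat.choose_succ_succ, Nat.factorial_succ, Nat.add_sub_add_right,
        show a - 1 - i = a - (i + 1) by omega]
      push_cast
      linear_combination ((-1 : ℂ) ^ (i + 1) * ((i + 1) * i.factorial) * a.choose (i + 1) *
        s ^ (i + 1) * z ^ (a - (i + 1))) * hp - ((-1 : ℂ) ^ i * i.factorial * b.choose i *
        s ^ (i + 1) * (z ^ (a - (i + 1)) * conj z ^ (b - i))) * hC i
    · simp [pow_succ]
      ring

/-- The inverse expansion has the same coefficients without signs: the recurrence is read as `z*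
H_{a,b} = H_{a,b+1} + s a H_{a-1,b}`. -/
lemma pow_mul_conj_pow_eq_sum (s : ℂ) (a b : ℕ) (z : ℂ) :
    z ^ a * conj z ^ b = ∑ j ∈ Finset.range (b + 1), (j.factorial : ℂ) *
      (a.choose j : ℂ) * (b.choose j : ℂ) * s ^ j * itoHermite s (a - j) (b - j) z := by
  induction b with
  | zero => simp [itoHermite]
  | succ b ih =>
    rw [pow_succ, ← mul_assoc, ih, Finset.sum_mul, Finset.sum_range_succ' _ (b + 1)]
    have hC : ∀ i, ((a - i : ℕ) : ℂ) * (a.choose i : ℂ) = (i + 1) * (a.choose (i + 1) : ℂ) := by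
      intro i
      have := Nat.choose_succ_right_eq a i
      rw [mul_comm, mul_comm ((i : ℂ) + 1)]
      exact_mod_cast this.symm
    have h1 : ∀ i ∈ Finset.range (b + 1), (i.factorial : ℂ) * (a.choose i : ℂ) *
        (b.choose i : ℂ) * s ^ i * itoHermite s (a - i) (b - i) z * conj z =
        (i.factorial : ℂ) * (a.choose i : ℂ) * (b.choose i : ℂ) * s ^ i *
          itoHermite s (a - i) (b + 1 - i) z +
        (((i + 1).factorial : ℂ) * (a.choose (i + 1) : ℂ) * (b.choose i : ℂ) * s ^ (i + 1) *
          itoHermite s (a - (i + 1)) (b - i) z) := by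
      intro i hi
      rw [Finset.mem_range] at hi
      rw [show b + 1 - i = b - i + 1 by omega, itoHermite, Nat.factorial_succ,
        show a - i - 1 = a - (i + 1) by omega]
      push_cast
      linear_combination ((i.factorial : ℂ) * b.choose i * s ^ (i + 1) *
        itoHermite s (a - (i + 1)) (b - i) z) * hC i
    rw [Finset.sum_congr rfl h1, Finset.sum_add_distrib, Finset.sum_range_succ' _ b]
    have h2 : ∑ k ∈ Finset.range b, ((k + 1).factorial : ℂ) * (a.choose (k + 1) : ℂ) *
        (b.choose (k + 1) : ℂ) * s ^ (k + 1) * itoHermite s (a - (k + 1)) (b + 1 - (k + 1)) z =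
        ∑ k ∈ Finset.range (b + 1), ((k + 1).factorial : ℂ) * (a.choose (k + 1) : ℂ) *
        (b.choose (k + 1) : ℂ) * s ^ (k + 1) * itoHermite s (a - (k + 1)) (b + 1 - (k + 1)) z := by
      rw [Finset.sum_range_succ _ b]
      simp
    rw [h2, add_right_comm, ← Finset.sum_add_distrib]
    congr 1
    · refine Finset.sum_congr rfl fun i _ => ?_
      rw [Nat.choose_succ_succ, Nat.add_sub_add_right]
      push_cast
      ring
    · simp

end Hermite

/-! ### Orthogonality of the Itô-Hermite polynomials -/

section HermiteMoments

variable {Ω : Type*} [MeasurableSpace Ω] {P : Measure Ω}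

lemma continuous_itoHermite (s : ℂ) (a b : ℕ) : Continuous (itoHermite s a b) := by
  have h : itoHermite s a b = fun z => ∑ i ∈ Finset.range (b + 1), (-1 : ℂ) ^ i *
      (i.factorial : ℂ) * (a.choose i : ℂ) * (b.choose i : ℂ) * s ^ i *
        (z ^ (a - i) * conj z ^ (b - i)) := funext fun z => itoHermite_eq_sum s a b z
  rw [h]
  fun_prop

lemma AllMoments.itoHermite [IsFiniteMeasure P] {Z : Ω → ℂ} (hZ : AllMoments Z P) (s : ℂ)
    (a b : ℕ) : AllMoments (fun ω => itoHermite s a b (Z ω)) P := by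
  simp only [itoHermite_eq_sum]
  exact AllMoments.sum _ fun i _ => ((hZ.pow _).mul (hZ.star.pow _)).const_mul _

namespace CircPair

variable {Z W : Ω → ℂ}

/-- The mixed moment `E[Z*^k H_{a,b}(Z) W^c W*^d]`. -/
def hermiteMoment (P : Measure Ω) (Z W : Ω → ℂ) (s : ℂ) (k a b c d : ℕ) : ℂ :=
  ∫ ω, conj (Z ω) ^ k * itoHermite s a b (Z ω) * (W ω ^ c * conj (W ω) ^ d) ∂P

lemma allMoments_hermite (h : CircPair P Z W) (s : ℂ) (k a b c d : ℕ) :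
    AllMoments (fun ω => conj (Z ω) ^ k * itoHermite s a b (Z ω) *
      (W ω ^ c * conj (W ω) ^ d)) P := by
  have := h.isProb
  exact ((h.allMoments_fst.star.pow k).mul (h.allMoments_fst.itoHermite s a b)).mul
    ((h.allMoments_snd.pow c).mul (h.allMoments_snd.star.pow d))

lemma hermiteMoment_succ (h : CircPair P Z W) (s : ℂ) (k a b c d : ℕ) :
    hermiteMoment P Z W s k a (b + 1) c d = hermiteMoment P Z W s (k + 1) a b c d -
      s * a * hermiteMoment P Z W s k (a - 1) b c d := by
  simp only [hermiteMoment]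
  rw [← integral_const_mul, ← integral_sub (h.allMoments_hermite s _ _ _ _ _).integrable
    ((h.allMoments_hermite s _ _ _ _ _).const_mul _).integrable]
  congr 1 with ω
  simp only [itoHermite]
  ring

/-- Integration by parts again, now with `∂H_{a,b}/∂z = a H_{a-1,b}`. The recurrence raises `k`
while it lowers `b`, so `k` stays general in the induction. -/
lemma hermiteMoment_stein (h : CircPair P Z W) {s : ℂ} (hs : s = (∫ ω, ‖Z ω‖ ^ 2 ∂P : ℝ))
    (b : ℕ) : ∀ k a c d : ℕ, hermiteMoment P Z W s (k + 1) a b c d =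
      s * a * hermiteMoment P Z W s k (a - 1) b c d +
      c * conj (∫ ω, Z ω * conj (W ω) ∂P) * hermiteMoment P Z W s k a b (c - 1) d := by
  induction b with
  | zero =>
    intro k a c d
    have hz : ∀ k a c d, hermiteMoment P Z W s k a 0 c d = mixedMoment P Z W a k c d := by
      intro k a c d
      simp only [hermiteMoment, mixedMoment, itoHermite]
      congr 1 with ω
      ring
    rw [hz, hz, hz, h.mixedMoment_stein, ← hs]
    ring
  | succ b ih =>
    intro k a c d
    simp only [h.hermiteMoment_succ, ih]
    ring

/-- The subtracted term in the recurrence is exactly the self-contraction of `Z` in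
`hermiteMoment_stein`, so only contractions of `Z` with `W` survive. -/
lemma hermiteMoment_eq (h : CircPair P Z W) {s : ℂ} (hs : s = (∫ ω, ‖Z ω‖ ^ 2 ∂P : ℝ))
    (a b c d : ℕ) : hermiteMoment P Z W s 0 a b c d =
      (∫ ω, Z ω * conj (W ω) ∂P) ^ a * conj (∫ ω, Z ω * conj (W ω) ∂P) ^ b *
        (c.descFactorial b * d.descFactorial a) * mixedMoment P Z W 0 0 (c - b) (d - a) := by
  induction b generalizing c with
  | zero =>
    have := h.mixedMoment_pow_left a c d
    simp only [mixedMoment, pow_zero, mul_one] at this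
    simp [hermiteMoment, itoHermite, this, mixedMoment]
  | succ b ih =>
    rw [h.hermiteMoment_succ, h.hermiteMoment_stein hs, ih]
    rcases c with _ | c
    · simp
    · rw [Nat.succ_descFactorial_succ, Nat.add_sub_cancel, Nat.add_sub_add_right]
      push_cast
      ring

lemma integral_itoHermite (h : CircPair P Z W) {s : ℂ} (hs : s = (∫ ω, ‖Z ω‖ ^ 2 ∂P : ℝ))
    (n : ℕ) : ∫ ω, itoHermite s (n + 1) n (Z ω) ∂P = 0 := by
  simpa [hermiteMoment] using h.hermiteMoment_eq hs (n + 1) n 0 0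

lemma integral_itoHermite_mul_conj (h : CircPair P Z W) (s s' : ℂ) (n n' : ℕ) :
    ∫ ω, itoHermite s (n + 1) n (Z ω) * conj (itoHermite s' (n' + 1) n' (W ω)) ∂P =
      ∑ i ∈ Finset.range (n' + 1), conj ((-1 : ℂ) ^ i * (i.factorial : ℂ) *
      ((n' + 1).choose i : ℂ) * (n'.choose i : ℂ) * s' ^ i) *
        hermiteMoment P Z W s 0 (n + 1) n (n' - i) (n' + 1 - i) := by
  simp only [hermiteMoment, ← integral_const_mul]
  rw [← integral_finsetSum _ fun i _ =>
    ((h.allMoments_hermite s _ _ _ _ _).const_mul _).integrable]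
  congr 1 with ω
  rw [itoHermite_eq_sum s' (n' + 1), map_sum, Finset.mul_sum]
  refine Finset.sum_congr rfl fun i _ => ?_
  simp only [map_mul, map_pow, Complex.conj_conj]
  ring

/-- The polynomial in `W` has too few factors to absorb the `n` factors `Z*`: a falling factorial
vanishes in every term. Only its degree matters, so `s'` is arbitrary. -/
lemma integral_itoHermite_mul_conj_of_lt (h : CircPair P Z W) {s : ℂ}
    (hs : s = (∫ ω, ‖Z ω‖ ^ 2 ∂P : ℝ)) (s' : ℂ) {n n' : ℕ} (hn : n' < n) :
    ∫ ω, itoHermite s (n + 1) n (Z ω) * conj (itoHermite s' (n' + 1) n' (W ω)) ∂P = 0 := by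
  rw [h.integral_itoHermite_mul_conj]
  refine Finset.sum_eq_zero fun i _ => ?_
  rw [h.hermiteMoment_eq hs, Nat.descFactorial_of_lt (by omega : n' - i < n)]
  simp

/-- By the same count only the leading monomial `i = 0` in `W` contributes. -/
lemma integral_itoHermite_mul_conj_self (h : CircPair P Z W) {s : ℂ}
    (hs : s = (∫ ω, ‖Z ω‖ ^ 2 ∂P : ℝ)) (s' : ℂ) (n : ℕ) :
    ∫ ω, itoHermite s (n + 1) n (Z ω) * conj (itoHermite s' (n + 1) n (W ω)) ∂P =
      ((n + 1).factorial : ℂ) * (n.factorial : ℂ) * ((∫ ω, Z ω * conj (W ω) ∂P) *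
        (‖∫ ω, Z ω * conj (W ω) ∂P‖ : ℂ) ^ (2 * n)) := by
  have := h.isProb
  rw [h.integral_itoHermite_mul_conj, Finset.sum_eq_single 0]
  · rw [h.hermiteMoment_eq hs]
    simp only [Nat.sub_zero, Nat.descFactorial_self, Nat.sub_self]
    rw [show (‖∫ ω, Z ω * conj (W ω) ∂P‖ : ℂ) ^ (2 * n) = (∫ ω, Z ω * conj (W ω) ∂P) ^ n *
      conj (∫ ω, Z ω * conj (W ω) ∂P) ^ n by rw [pow_mul, ← mul_pow, Complex.mul_conj']]
    simp [mixedMoment]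
    ring
  · intro i hi hi0
    rw [Finset.mem_range] at hi
    rw [h.hermiteMoment_eq hs, Nat.descFactorial_of_lt (by omega : n - i < n)]
    simp
  · simp

/-- Orthogonality of the Itô-Hermite polynomials of a circularly symmetric Gaussian pair. -/
lemma integral_itoHermite_mul_conj_of_ne (h : CircPair P Z W) {s s' : ℂ}
    (hs : s = (∫ ω, ‖Z ω‖ ^ 2 ∂P : ℝ)) (hs' : s' = (∫ ω, ‖W ω‖ ^ 2 ∂P : ℝ)) {n n' : ℕ}
    (hn : n ≠ n') :
    ∫ ω, itoHermite s (n + 1) n (Z ω) * conj (itoHermite s' (n' + 1) n' (W ω)) ∂P = 0 := by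
  rcases lt_or_gt_of_ne hn with hlt | hlt
  · have h1 := congrArg conj (h.swap.integral_itoHermite_mul_conj_of_lt hs' s hlt)
    rw [← integral_conj, map_zero] at h1
    rw [← h1]
    congr 1 with ω
    simp only [map_mul, Complex.conj_conj]
    ring
  · exact h.integral_itoHermite_mul_conj_of_lt hs s' hlt

end CircPair

end HermiteMoments

/-! ### Hermite expansion of the memory polynomial -/

section Expansion

lemma mem_oddIcc {l u k : ℕ} : k ∈ oddIcc l u ↔ l ≤ k ∧ k ≤ u ∧ Odd k := by
  simp [oddIcc, and_assoc]

/-- The Itô-Hermite polynomial of odd total degree `ϖ`, with variance `s`. -/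
def oddHermite (s : ℂ) (ϖ : ℕ) (z : ℂ) : ℂ := itoHermite s ((ϖ + 1) / 2) ((ϖ - 1) / 2) z

lemma oddHermite_odd (s : ℂ) (n : ℕ) (z : ℂ) :
    oddHermite s (2 * n + 1) z = itoHermite s (n + 1) n z := by
  rw [oddHermite, show (2 * n + 1 + 1) / 2 = n + 1 by omega, show (2 * n + 1 - 1) / 2 = n by omega]

/-- Rescaling turns unit variance into variance `σ²`. The right-hand side also makes sense for `σ =
0`, which is why later arguments use `oddHermite`. -/
lemma pow_mul_hermite_div {σ : ℝ} (hσ : σ ≠ 0) {ϖ : ℕ} (hϖ : Odd ϖ) (z : ℂ) :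
    (σ : ℂ) ^ ϖ * hermite ϖ (z / σ) = oddHermite ((σ : ℂ) ^ 2) ϖ z := by
  obtain ⟨n, rfl⟩ := hϖ
  rw [oddHermite_odd, itoHermite_eq_sum, hermite, show (2 * n + 1 + 1) / 2 = n + 1 by omega,
    show (2 * n + 1 - 1) / 2 = n by omega, Finset.mul_sum]
  refine Finset.sum_congr rfl fun i hi => ?_
  have hin : i ≤ n := by
    rw [Finset.mem_range] at hi
    omega
  obtain ⟨k, rfl⟩ := Nat.exists_eq_add_of_le hin
  have hσ' : (σ : ℂ) ≠ 0 := by exact_mod_cast hσ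
  have h1 : ((‖z / (σ : ℂ)‖ : ℝ) : ℂ) ^ (2 * k) = z ^ k * conj z ^ k / (σ : ℂ) ^ (2 * k) := by
    rw [pow_mul, ← Complex.mul_conj', map_div₀, Complex.conj_ofReal, pow_mul, ← mul_pow, ← div_pow]
    congr 1
    field_simp
  rw [show 2 * (i + k) + 1 - 1 - 2 * i = 2 * k by omega, h1, show i + k + 1 - i = k + 1 by omega,
    show i + k - i = k by omega]
  field_simp
  ring

lemma mul_norm_pow_eq_sum (s : ℂ) {κ : ℕ} (hκ : Odd κ) (z : ℂ) :
    z * (‖z‖ : ℂ) ^ (κ - 1) = ∑ ϖ ∈ oddIcc 1 κ,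
      ((((κ - ϖ) / 2).factorial * ((κ + 1) / 2).choose ((κ - ϖ) / 2) *
        ((κ - 1) / 2).choose ((κ - ϖ) / 2) : ℕ) : ℂ) * s ^ ((κ - ϖ) / 2) * oddHermite s ϖ z := by
  obtain ⟨n, rfl⟩ := hκ
  have h1 : z * (‖z‖ : ℂ) ^ (2 * n + 1 - 1) = z ^ (n + 1) * conj z ^ n := by
    rw [Nat.add_sub_cancel, pow_mul, ← Complex.mul_conj']
    ring
  rw [h1, pow_mul_conj_pow_eq_sum s]
  -- Removing `j` contractions from degree `κ = 2n+1` leaves degree `ϖ = 2(n-j)+1`.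
  refine Finset.sum_bij' (fun j _ => 2 * (n - j) + 1) (fun ϖ _ => (2 * n + 1 - ϖ) / 2) ?_ ?_ ?_ ?_ ?_
  · intro j hj
    rw [mem_oddIcc]
    exact ⟨by omega, by omega, ⟨n - j, rfl⟩⟩
  · intro ϖ hϖ
    rw [Finset.mem_range]
    rw [mem_oddIcc] at hϖ
    omega
  · intro j hj
    rw [Finset.mem_range] at hj
    omega
  · intro ϖ hϖ
    obtain ⟨h1, h2, k, rfl⟩ := mem_oddIcc.1 hϖ
    omega
  · intro j hj
    rw [Finset.mem_range] at hj
    rw [oddHermite_odd, show (2 * n + 1 - (2 * (n - j) + 1)) / 2 = j by omega,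
      show (2 * n + 1 + 1) / 2 = n + 1 by omega, show (2 * n + 1 - 1) / 2 = n by omega,
      show n + 1 - j = n - j + 1 by omega]
    push_cast
    ring

/-- Exchanging the sums over `ϖ ≤ κ` explains the form of the kernels: `a_ϖ` collects the degree `ϖ`
contributions of all orders `κ`. -/
lemma sum_hermiteKernel_mul (N : ℕ) (b : ℕ → ℝ → ℂ) (σ τ : ℝ) (z : ℂ) :
    ∑ ϖ ∈ oddIcc 1 N, hermiteKernel N b σ ϖ τ * oddHermite ((σ : ℂ) ^ 2) ϖ z =
      ∑ κ ∈ oddIcc 1 N, b κ τ * (z * (‖z‖ : ℂ) ^ (κ - 1)) := by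
  simp only [hermiteKernel, Finset.sum_mul]
  rw [Finset.sum_comm' (t' := oddIcc 1 N) (s' := fun κ => oddIcc 1 κ)]
  · refine Finset.sum_congr rfl fun κ hκ => ?_
    obtain ⟨-, -, hκ⟩ := mem_oddIcc.1 hκ
    rw [mul_norm_pow_eq_sum ((σ : ℂ) ^ 2) hκ, Finset.mul_sum]
    refine Finset.sum_congr rfl fun ϖ hϖ => ?_
    obtain ⟨-, h2, hϖ⟩ := mem_oddIcc.1 hϖ
    rw [← pow_mul, show 2 * ((κ - ϖ) / 2) = κ - ϖ by
      obtain ⟨k, hk⟩ := hκ; obtain ⟨l, hl⟩ := hϖ; omega]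
    ring
  · intro ϖ κ
    simp only [mem_oddIcc]
    constructor
    · rintro ⟨⟨h1, h2, h3⟩, h4, h5, h6⟩
      exact ⟨⟨h1, h4, h3⟩, by omega, h5, h6⟩
    · rintro ⟨⟨h1, h2, h3⟩, h4, h5, h6⟩
      exact ⟨⟨h1, by omega, h3⟩, h2, h5, h6⟩

end Expansion

/-! ### Calculus and uniqueness of spectra -/

section Spectra

/-- The character `exp (2πi f τ)`. -/
def expChar (f τ : ℝ) : ℂ := Complex.exp ((2 * Real.pi * f * τ : ℝ) * Complex.I)

lemma norm_expChar (f τ : ℝ) : ‖expChar f τ‖ = 1 := Complex.norm_exp_ofReal_mul_I _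

lemma conj_expChar (f τ : ℝ) : conj (expChar f τ) = expChar f (-τ) := by
  rw [expChar, expChar, ← Complex.exp_conj, map_mul, Complex.conj_ofReal, Complex.conj_I]
  congr 1
  push_cast
  ring

lemma expChar_add (f τ τ' : ℝ) : expChar f (τ + τ') = expChar f τ * expChar f τ' := by
  rw [expChar, expChar, expChar, ← Complex.exp_add]
  congr 1
  push_cast
  ring

lemma expChar_neg_left (f τ : ℝ) : expChar (-f) τ = expChar f (-τ) := by
  rw [expChar, expChar]
  congr 2
  push_cast
  ring

lemma continuous_expChar : Continuous fun p : ℝ × ℝ => expChar p.1 p.2 := by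
  unfold expChar
  fun_prop

lemma fourierInv_eq_integral (S : ℝ → ℂ) (τ : ℝ) : 𝓕⁻ S τ = ∫ f, expChar f τ * S f := by
  rw [Real.fourierInv_eq']
  congr 1 with f
  rw [expChar, smul_eq_mul]
  congr 4
  simp
  ring

lemma fourier_eq_integral (a : ℝ → ℂ) (f : ℝ) : 𝓕 a f = ∫ τ, expChar f (-τ) * a τ := by
  rw [Real.fourier_real_eq_integral_exp_smul]
  congr 1 with τ
  rw [expChar, smul_eq_mul]
  congr 4
  ring

lemma integrable_expChar_mul {S : ℝ → ℂ} (hS : Integrable S) (τ : ℝ) :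
    Integrable fun f => expChar f τ * S f :=
  hS.bdd_mul (c := 1) (continuous_expChar.comp (by fun_prop : Continuous fun f : ℝ =>
    (f, τ))).aestronglyMeasurable (ae_of_all _ fun f => (norm_expChar f τ).le)

lemma IsSpectrum.mul {R R' S S' : ℝ → ℂ} (h : IsSpectrum R S) (h' : IsSpectrum R' S') :
    IsSpectrum (fun τ => R τ * R' τ) (S ⋆[ContinuousLinearMap.mul ℂ ℂ, volume] S') := by
  refine ⟨h.1.integrable_convolution _ h'.1, fun τ => ?_⟩
  change R τ * R' τ = _
  rw [h.2, h'.2]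
  simp only [Real.fourierInv_eq_fourier_neg]
  rw [Real.fourier_mul_convolution_eq h.1 h'.1]

lemma IsSpectrum.conj {R S : ℝ → ℂ} (h : IsSpectrum R S) :
    IsSpectrum (fun τ => conj (R τ)) (fun f => conj (S (-f))) := by
  refine ⟨?_, fun τ => ?_⟩
  · exact Complex.conjCLE.toContinuousLinearMap.integrable_comp h.1.comp_neg
  · change (starRingEnd ℂ) (R τ) = _
    rw [h.2, fourierInv_eq_integral, fourierInv_eq_integral, ← integral_conj,
      ← integral_neg_eq_self]
    congr 1 with f
    simp only [map_mul, conj_expChar, expChar_neg_left, neg_neg]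

lemma IsSpectrum.const_mul {R S : ℝ → ℂ} (h : IsSpectrum R S) (c : ℂ) :
    IsSpectrum (fun τ => c * R τ) (fun f => c * S f) := by
  refine ⟨h.1.const_mul c, fun τ => ?_⟩
  change c * R τ = _
  rw [h.2, fourierInv_eq_integral, fourierInv_eq_integral, ← integral_const_mul]
  congr 1 with f
  ring

lemma IsSpectrum.sum {ι : Type*} (s : Finset ι) {R S : ι → ℝ → ℂ}
    (h : ∀ i ∈ s, IsSpectrum (R i) (S i)) :
    IsSpectrum (fun τ => ∑ i ∈ s, R i τ) (fun f => ∑ i ∈ s, S i f) := by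
  refine ⟨integrable_finsetSum _ fun i hi => (h i hi).1, fun τ => ?_⟩
  rw [fourierInv_eq_integral]
  simp only [Finset.mul_sum]
  rw [integral_finsetSum _ fun i hi => integrable_expChar_mul (h i hi).1 τ]
  exact Finset.sum_congr rfl fun i hi => by rw [(h i hi).2, fourierInv_eq_integral]

lemma IsSpectrum.iterConv {F R f g : ℝ → ℂ} (hf : IsSpectrum F f) (hg : IsSpectrum R g) (n : ℕ) :
    IsSpectrum (fun τ => F τ * R τ ^ n) (iterConv f g n) := by
  induction n with
  | zero => simpa [MemPoly.iterConv] using hf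
  | succ n ih => simpa only [pow_succ, mul_assoc, MemPoly.iterConv] using ih.mul hg

/-- Since `R |R|^(2n) = R · R^n · (R*)^n`, the product and conjugation rules apply. -/
lemma isSpectrum_termSpec {R S : ℝ → ℂ} (h : IsSpectrum R S) {ϖ : ℕ} (hϖ : Odd ϖ) :
    IsSpectrum (termCorr ϖ R) (termSpec ϖ S) := by
  obtain ⟨n, rfl⟩ := hϖ
  have h1 := (((h.iterConv h n).iterConv h.conj n).const_mul (termConst (2 * n + 1)))
  have h2 : termSpec (2 * n + 1) S = fun f => termConst (2 * n + 1) *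
      MemPoly.iterConv (MemPoly.iterConv S S n) (fun φ => conj (S (-φ))) n f := by
    funext f
    rw [termSpec, show (2 * n + 1 - 1) / 2 = n by omega]
  rw [h2]
  refine ⟨h1.1, fun τ => ?_⟩
  rw [← h1.2, termCorr, Nat.add_sub_cancel, pow_mul, ← Complex.mul_conj', mul_pow]
  ring

/-- The spectrum is unique up to null sets. -/
lemma IsSpectrum.ae_eq {R S S' : ℝ → ℂ} (h : IsSpectrum R S) (h' : IsSpectrum R S') :
    S =ᵐ[volume] S' := by
  have hT := h.1.sub h'.1
  have hF : ∀ τ, 𝓕 (S - S') τ = 0 := by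
    intro τ
    have h1 := (h.2 (-τ)).symm.trans (h'.2 (-τ))
    rw [fourierInv_eq_integral, fourierInv_eq_integral] at h1
    rw [fourier_eq_integral]
    have h2 : ∀ f, expChar τ (-f) = expChar f (-τ) := by
      intro f
      rw [expChar, expChar]
      congr 2
      push_cast
      ring
    simp only [h2, Pi.sub_apply, mul_sub]
    rw [integral_sub (integrable_expChar_mul h.1 _) (integrable_expChar_mul h'.1 _), h1, sub_self]
  -- A smooth compactly supported test function is the Fourier transform of a Schwartz function.
  -- Moving that transform onto `S - S'` gives an integral against zero.
  have hz : ∀ᵐ f, (S - S') f = 0 := by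
    refine ae_eq_zero_of_integral_contDiff_smul_eq_zero hT.locallyIntegrable fun g hg hgc => ?_
    let G : SchwartzMap ℝ ℂ := HasCompactSupport.toSchwartzMap (f := fun x => (g x : ℂ))
      (hgc.comp_left (g := fun r : ℝ => (r : ℂ)) Complex.ofReal_zero)
      (Complex.ofRealCLM.contDiff.comp hg)
    have hG : ∀ x, (𝓕 (𝓕⁻ G : SchwartzMap ℝ ℂ) : SchwartzMap ℝ ℂ) x = g x := by
      intro x
      simp only [FourierTransform.fourier_fourierInv_eq]
      rfl
    have h1 : ∫ x, 𝓕 (⇑(𝓕⁻ G : SchwartzMap ℝ ℂ)) x • (S - S') x =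
        ∫ x, (𝓕⁻ G : SchwartzMap ℝ ℂ) x • 𝓕 (S - S') x := by
      have h0 := VectorFourier.integral_fourierIntegral_smul_eq_flip (L := innerₗ ℝ)
        Real.continuous_fourierChar continuous_inner
        (SchwartzMap.integrable (μ := volume) (𝓕⁻ G : SchwartzMap ℝ ℂ)) hT
      rwa [flip_innerₗ] at h0
    simp only [hF, smul_zero, integral_zero, ← SchwartzMap.fourier_coe, hG] at h1
    simpa [Complex.real_smul] using h1
  filter_upwards [hz] with f hf
  exact sub_eq_zero.1 hf

/-- Filtering a correlation function with the kernels `a` and `a'` multiplies the spectrum with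
the transfer functions. -/
lemma integral_filter_fourierInv {a a' S : ℝ → ℂ} (ha : Integrable a) (ha' : Integrable a')
    (hS : Integrable S) (t t' : ℝ) :
    ∫ p : ℝ × ℝ, a (t - p.1) * conj (a' (t' - p.2)) * 𝓕⁻ S (p.1 - p.2) =
      𝓕⁻ (fun f => 𝓕 a f * conj (𝓕 a' f) * S f) (t - t') := by
  have hca' : Integrable fun τ => conj (a' (t' - τ)) :=
    Complex.conjCLE.toContinuousLinearMap.integrable_comp (ha'.comp_sub_left t')
  -- The character has modulus one, so the integrand is dominated by a product of three integrable
  -- functions and Fubini applies.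
  have hint : Integrable (Function.uncurry fun (p : ℝ × ℝ) (f : ℝ) =>
      expChar f (p.1 - p.2) * (a (t - p.1) * conj (a' (t' - p.2)) * S f))
      ((volume.prod volume).prod volume) := by
    refine (((ha.comp_sub_left t).mul_prod hca').mul_prod hS).bdd_mul (c := 1)
      (Continuous.aestronglyMeasurable ?_) (ae_of_all _ fun q => (norm_expChar _ _).le)
    exact continuous_expChar.comp (by fun_prop : Continuous fun q : (ℝ × ℝ) × ℝ =>
      (q.2, q.1.1 - q.1.2))
  have hshift : ∀ (c : ℝ → ℂ) (f s : ℝ), ∫ τ, expChar f τ * c (s - τ) = expChar f s * 𝓕 c f := by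
    intro c f s
    rw [fourier_eq_integral, ← integral_const_mul, ← integral_sub_left_eq_self _ _ s]
    congr 1 with τ
    rw [sub_sub_cancel, sub_eq_add_neg, expChar_add]
    ring
  calc ∫ p : ℝ × ℝ, a (t - p.1) * conj (a' (t' - p.2)) * 𝓕⁻ S (p.1 - p.2)
      = ∫ p : ℝ × ℝ, ∫ f, expChar f (p.1 - p.2) * (a (t - p.1) * conj (a' (t' - p.2)) * S f) := by
        congr 1 with p
        rw [fourierInv_eq_integral, ← integral_const_mul]
        congr 1 with f
        ring
    _ = ∫ f, ∫ p : ℝ × ℝ, expChar f (p.1 - p.2) * (a (t - p.1) * conj (a' (t' - p.2)) * S f) :=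
        integral_integral_swap hint
    _ = _ := by
        rw [fourierInv_eq_integral]
        congr 1 with f
        have h1 : ∀ p : ℝ × ℝ,
            expChar f (p.1 - p.2) * (a (t - p.1) * conj (a' (t' - p.2)) * S f) =
            S f * ((expChar f p.1 * a (t - p.1)) * conj (expChar f p.2 * a' (t' - p.2))) := by
          intro p
          rw [sub_eq_add_neg, expChar_add, map_mul, conj_expChar]
          ring
        simp only [h1]
        rw [integral_const_mul, Measure.volume_eq_prod,
          integral_prod_mul (fun τ => expChar f τ * a (t - τ))
          (fun τ => conj (expChar f τ * a' (t' - τ))), integral_conj, hshift, hshift, map_mul,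
          conj_expChar, sub_eq_add_neg t t', expChar_add]
        ring

lemma integrable_fourier_mul {a a' S : ℝ → ℂ} (ha : Integrable a) (ha' : Integrable a')
    (hS : Integrable S) : Integrable fun f => 𝓕 a f * conj (𝓕 a' f) * S f := by
  have hcont : ∀ {c : ℝ → ℂ}, Integrable c → Continuous (𝓕 c) := fun hc =>
    VectorFourier.fourierIntegral_continuous Real.continuous_fourierChar continuous_inner hc
  have hbd : ∀ (c : ℝ → ℂ) f, ‖𝓕 c f‖ ≤ ∫ τ, ‖c τ‖ := fun c f =>
    VectorFourier.norm_fourierIntegral_le_integral_norm _ _ _ _ _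
  refine hS.bdd_mul (c := (∫ τ, ‖a τ‖) * ∫ τ, ‖a' τ‖)
    ((hcont ha).mul (Complex.continuous_conj.comp (hcont ha'))).aestronglyMeasurable
    (ae_of_all _ fun f => ?_)
  rw [norm_mul, RCLike.norm_conj]
  exact mul_le_mul (hbd a f) (hbd a' f) (norm_nonneg _) (integral_nonneg fun _ => norm_nonneg _)

end Spectra

/-! ### Second-order statistics of filtered processes -/

section Filtering

/-- The integral of the process `h`, weighted with `α`. -/
def weighted {Ω : Type*} (α : ℝ → ℂ) (h : ℝ → Ω → ℂ) (ω : Ω) : ℂ := ∫ τ, α τ * h τ ω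

lemma weighted_mul_conj {Ω : Type*} (α α' : ℝ → ℂ) (h h' : ℝ → Ω → ℂ) (ω : Ω) :
    weighted α h ω * conj (weighted α' h' ω) = ∫ p : ℝ × ℝ, (α p.1 * conj (α' p.2)) *
      (h p.1 ω * conj (h' p.2 ω)) ∂(volume.prod volume) := by
  rw [weighted, weighted, ← integral_conj,
    ← integral_prod_mul (fun τ => α τ * h τ ω) (fun τ => conj (α' τ * h' τ ω))]
  congr 1 with p
  rw [map_mul]
  ring

variable {Ω : Type*} [MeasurableSpace Ω] {P : Measure Ω}

/-- Integrating over `ω` first leaves a function dominated by `C ‖α‖`. The index space is general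
because it is used for `ℝ` (means) and for `ℝ × ℝ` (correlations). -/
lemma integrable_prod_mul_of_bdd [IsProbabilityMeasure P] {T : Type*} [MeasurableSpace T]
    {ν : Measure T} [SFinite ν]
    {α : T → ℂ} (hα : Integrable α ν) {h : T → Ω → ℂ} (hm : Measurable (Function.uncurry h))
    (hi : ∀ τ, Integrable (h τ) P) {C : ℝ} (hC : ∀ τ, ∫ ω, ‖h τ ω‖ ∂P ≤ C) :
    Integrable (fun q : Ω × T => α q.2 * h q.2 q.1) (P.prod ν) := by
  have hsm : AEStronglyMeasurable (fun q : Ω × T => α q.2 * h q.2 q.1) (P.prod ν) :=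
    (hα.aestronglyMeasurable.comp_snd).mul (hm.comp measurable_swap).aestronglyMeasurable
  rw [integrable_prod_iff' hsm]
  refine ⟨ae_of_all _ fun τ => (hi τ).const_mul (α τ), ?_⟩
  refine (hα.norm.mul_const C).mono' hsm.norm.prod_swap.integral_prod_right'
    (ae_of_all _ fun τ => ?_)
  rw [Real.norm_of_nonneg (integral_nonneg fun _ => norm_nonneg _)]
  simp only [norm_mul]
  rw [integral_const_mul]
  exact mul_le_mul_of_nonneg_left (hC τ) (norm_nonneg _)

/-- A jointly measurable process with uniformly bounded second moments. -/
structure IsBddSignal (P : Measure Ω) (h : ℝ → Ω → ℂ) : Prop where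
  measurable : Measurable (Function.uncurry h)
  memLp : ∀ τ, MemLp (h τ) 2 P
  bdd : ∃ C : ℝ, ∀ τ, ∫ ω, ‖h τ ω‖ ^ 2 ∂P ≤ C

namespace IsBddSignal

variable {h h' : ℝ → Ω → ℂ} {α α' : ℝ → ℂ}

lemma integrable [IsProbabilityMeasure P] (hh : IsBddSignal P h) (τ : ℝ) : Integrable (h τ) P :=
  (hh.memLp τ).integrable (by norm_num)

lemma integrable_mul_conj (hh : IsBddSignal P h) (hh' : IsBddSignal P h') (τ τ' : ℝ) :
    Integrable (fun ω => h τ ω * conj (h' τ' ω)) P :=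
  (hh.memLp τ).integrable_mul (hh'.memLp τ').star

lemma integrable_prod [IsProbabilityMeasure P] (hh : IsBddSignal P h) (hα : Integrable α) :
    Integrable (fun q : Ω × ℝ => α q.2 * h q.2 q.1) (P.prod volume) := by
  obtain ⟨C, hC⟩ := hh.bdd
  refine integrable_prod_mul_of_bdd hα hh.measurable hh.integrable (C := 1 + C) fun τ => ?_
  have hsq := (hh.memLp τ).integrable_norm_pow (by simp)
  calc ∫ ω, ‖h τ ω‖ ∂P ≤ ∫ ω, (1 + ‖h τ ω‖ ^ 2) ∂P := by
        refine integral_mono (hh.integrable τ).norm ((integrable_const 1).add hsq) fun ω => ?_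
        nlinarith [sq_nonneg (‖h τ ω‖ - 1), sq_nonneg (‖h τ ω‖)]
    _ = 1 + ∫ ω, ‖h τ ω‖ ^ 2 ∂P := by
        rw [integral_add (integrable_const 1) hsq]
        simp
    _ ≤ 1 + C := by linarith [hC τ]

lemma integrable_prod_prod [IsProbabilityMeasure P] (hh : IsBddSignal P h)
    (hh' : IsBddSignal P h') (hα : Integrable α)
    (hα' : Integrable α') :
    Integrable (fun q : Ω × (ℝ × ℝ) => (α q.2.1 * conj (α' q.2.2)) *
      (h q.2.1 q.1 * conj (h' q.2.2 q.1))) (P.prod (volume.prod volume)) := by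
  obtain ⟨C, hC⟩ := hh.bdd
  obtain ⟨C', hC'⟩ := hh'.bdd
  have hcα' : Integrable fun τ => conj (α' τ) :=
    Complex.conjCLE.toContinuousLinearMap.integrable_comp hα'
  refine integrable_prod_mul_of_bdd (T := ℝ × ℝ) (h := fun p ω => h p.1 ω * conj (h' p.2 ω))
    (hα.mul_prod hcα') ?_ (fun p => hh.integrable_mul_conj hh' p.1 p.2) (C := C + C') fun p => ?_
  · have h1 : Measurable fun q : (ℝ × ℝ) × Ω => h q.1.1 q.2 :=
      hh.measurable.comp (by fun_prop : Measurable fun q : (ℝ × ℝ) × Ω => (q.1.1, q.2))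
    have h2 : Measurable fun q : (ℝ × ℝ) × Ω => h' q.1.2 q.2 :=
      hh'.measurable.comp (by fun_prop : Measurable fun q : (ℝ × ℝ) × Ω => (q.1.2, q.2))
    exact h1.mul (Complex.continuous_conj.measurable.comp h2)
  · have hsq := (hh.memLp p.1).integrable_norm_pow (by simp)
    have hsq' := (hh'.memLp p.2).integrable_norm_pow (by simp)
    calc ∫ ω, ‖h p.1 ω * conj (h' p.2 ω)‖ ∂P
        ≤ ∫ ω, (‖h p.1 ω‖ ^ 2 + ‖h' p.2 ω‖ ^ 2) ∂P := by
          refine integral_mono (hh.integrable_mul_conj hh' p.1 p.2).norm (hsq.add hsq') fun ω => ?_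
          simp only [norm_mul, RCLike.norm_conj]
          nlinarith [sq_nonneg (‖h p.1 ω‖ - ‖h' p.2 ω‖), norm_nonneg (h p.1 ω),
            norm_nonneg (h' p.2 ω), sq_nonneg (‖h p.1 ω‖), sq_nonneg (‖h' p.2 ω‖)]
      _ = ∫ ω, ‖h p.1 ω‖ ^ 2 ∂P + ∫ ω, ‖h' p.2 ω‖ ^ 2 ∂P := integral_add hsq hsq'
      _ ≤ C + C' := add_le_add (hC _) (hC' _)

lemma ae_integrable [IsProbabilityMeasure P] (hh : IsBddSignal P h) (hα : Integrable α) :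
    ∀ᵐ ω ∂P, Integrable fun τ => α τ * h τ ω :=
  (hh.integrable_prod hα).prod_right_ae

/-- The squared modulus is a double integral over pairs of times, integrable in `ω` by Fubini. -/
lemma memLp_weighted [IsProbabilityMeasure P] (hh : IsBddSignal P h) (hα : Integrable α) :
    MemLp (weighted α h) 2 P := by
  have hsm : AEStronglyMeasurable (weighted α h) P :=
    (hh.integrable_prod hα).integral_prod_left.aestronglyMeasurable
  rw [memLp_two_iff_integrable_sq_norm hsm]
  have h1 := (hh.integrable_prod_prod hh hα hα).integral_prod_left.norm
  refine h1.congr (ae_of_all _ fun ω => ?_)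
  change ‖∫ p : ℝ × ℝ, (α p.1 * conj (α p.2)) * (h p.1 ω * conj (h p.2 ω))
    ∂(volume.prod volume)‖ = ‖weighted α h ω‖ ^ 2
  rw [← weighted_mul_conj, norm_mul, RCLike.norm_conj, sq]

lemma integral_weighted [IsProbabilityMeasure P] (hh : IsBddSignal P h) (hα : Integrable α) :
    ∫ ω, weighted α h ω ∂P = ∫ τ, α τ * ∫ ω, h τ ω ∂P := by
  unfold weighted
  rw [integral_integral_swap (hh.integrable_prod hα)]
  simp only [integral_const_mul]

lemma integral_weighted_mul_conj [IsProbabilityMeasure P] (hh : IsBddSignal P h)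
    (hh' : IsBddSignal P h')
    (hα : Integrable α) (hα' : Integrable α') :
    ∫ ω, weighted α h ω * conj (weighted α' h' ω) ∂P =
      ∫ p : ℝ × ℝ, α p.1 * conj (α' p.2) * ∫ ω, h p.1 ω * conj (h' p.2 ω) ∂P := by
  simp only [weighted_mul_conj]
  rw [integral_integral_swap (hh.integrable_prod_prod hh' hα hα')]
  simp only [integral_const_mul]
  rfl

/-- The cross-correlation of two filtered processes. -/
lemma integral_filter_mul_conj [IsProbabilityMeasure P] (hh : IsBddSignal P h)
    (hh' : IsBddSignal P h')
    {a a' S : ℝ → ℂ} (ha : Integrable a) (ha' : Integrable a') (hS : Integrable S)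
    (hcorr : ∀ τ τ', ∫ ω, h τ ω * conj (h' τ' ω) ∂P = 𝓕⁻ S (τ - τ')) (t t' : ℝ) :
    ∫ ω, weighted (fun τ => a (t - τ)) h ω * conj (weighted (fun τ => a' (t' - τ)) h' ω) ∂P =
      𝓕⁻ (fun f => 𝓕 a f * conj (𝓕 a' f) * S f) (t - t') := by
  rw [hh.integral_weighted_mul_conj hh' (ha.comp_sub_left t) (ha'.comp_sub_left t'),
    ← integral_filter_fourierInv ha ha' hS]
  simp only [hcorr]

end IsBddSignal

/-- A family of orthogonal components: centered signals with finite second moments, such that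
components of different degree are uncorrelated, and those of the same degree have the
cross-spectra `S`. -/
structure IsOrthFamily {M : ℕ} (P : Measure Ω) (D : Set ℕ) (v : ℕ → Fin M → ℝ → Ω → ℂ)
    (S : ℕ → Fin M → Fin M → ℝ → ℂ) : Prop where
  memLp : ∀ ϖ ∈ D, ∀ m t, MemLp (v ϖ m t) 2 P
  mean : ∀ ϖ ∈ D, ∀ m t, ∫ ω, v ϖ m t ω ∂P = 0
  spec : ∀ ϖ ∈ D, ∀ m m', Integrable (S ϖ m m')
  corr_self : ∀ ϖ ∈ D, ∀ m m' t t',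
    ∫ ω, v ϖ m t ω * conj (v ϖ m' t' ω) ∂P = 𝓕⁻ (S ϖ m m') (t - t')
  corr_ne : ∀ ϖ ∈ D, ∀ ϖ' ∈ D, ϖ ≠ ϖ' → ∀ m m' t t',
    ∫ ω, v ϖ m t ω * conj (v ϖ' m' t' ω) ∂P = 0

namespace IsOrthFamily

variable {M : ℕ} {D : Set ℕ} {v : ℕ → Fin M → ℝ → Ω → ℂ} {S : ℕ → Fin M → Fin M → ℝ → ℂ}
  {z z' : Fin M → ℝ → Ω → ℂ} {s s' : Finset ℕ}

/-- Only equal degrees survive the double sum. The case `s = s'` gives stationarity and spectra,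
disjoint `s` and `s'` give uncorrelatedness. -/
lemma integral_mul_conj (hv : IsOrthFamily P D v S) (hs : ↑s ⊆ D) (hs' : ↑s' ⊆ D)
    (hz : ∀ m t, ∀ᵐ ω ∂P, z m t ω = ∑ ϖ ∈ s, v ϖ m t ω)
    (hz' : ∀ m t, ∀ᵐ ω ∂P, z' m t ω = ∑ ϖ ∈ s', v ϖ m t ω) (m m' : Fin M) (t t' : ℝ) :
    ∫ ω, z m t ω * conj (z' m' t' ω) ∂P = ∑ ϖ ∈ s ∩ s', 𝓕⁻ (S ϖ m m') (t - t') := by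
  have h1 : ∀ᵐ ω ∂P, z m t ω * conj (z' m' t' ω) =
      ∑ ϖ ∈ s, ∑ ϖ' ∈ s', v ϖ m t ω * conj (v ϖ' m' t' ω) := by
    filter_upwards [hz m t, hz' m' t'] with ω h1 h2
    rw [h1, h2, map_sum, Finset.sum_mul_sum]
  have hint : ∀ ϖ ∈ s, ∀ ϖ' ∈ s', Integrable (fun ω => v ϖ m t ω * conj (v ϖ' m' t' ω)) P :=
    fun ϖ h ϖ' h' => (hv.memLp ϖ (hs h) m t).integrable_mul (hv.memLp ϖ' (hs' h') m' t').star
  rw [integral_congr_ae h1, integral_finsetSum _ fun ϖ h =>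
    integrable_finsetSum _ fun ϖ' h' => hint ϖ h ϖ' h']
  rw [← Finset.filter_mem_eq_inter, Finset.sum_filter]
  refine Finset.sum_congr rfl fun ϖ h => ?_
  rw [integral_finsetSum _ fun ϖ' h' => hint ϖ h ϖ' h']
  split_ifs with hmem
  · rw [Finset.sum_eq_single ϖ, hv.corr_self ϖ (hs h)]
    · exact fun ϖ' h' hne => hv.corr_ne ϖ (hs h) ϖ' (hs' h') hne.symm _ _ _ _
    · exact fun hn => absurd hmem hn
  · refine Finset.sum_eq_zero fun ϖ' h' => hv.corr_ne ϖ (hs h) ϖ' (hs' h') ?_ _ _ _ _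
    rintro rfl
    exact hmem h'

lemma isJointlyWSS [IsProbabilityMeasure P] (hv : IsOrthFamily P D v S) (hs : ↑s ⊆ D)
    (hz : ∀ m t, ∀ᵐ ω ∂P, z m t ω = ∑ ϖ ∈ s, v ϖ m t ω) : IsJointlyWSS z P := by
  have hmean : ∀ m t, ∫ ω, z m t ω ∂P = 0 := by
    intro m t
    rw [integral_congr_ae (hz m t), integral_finsetSum _ fun ϖ h =>
      (hv.memLp ϖ (hs h) m t).integrable (by norm_num)]
    exact Finset.sum_eq_zero fun ϖ h => hv.mean ϖ (hs h) m t
  refine ⟨fun m t => ?_, fun m t => by rw [hmean, hmean], fun m m' t τ => ?_⟩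
  · exact (memLp_finsetSum s fun ϖ h => hv.memLp ϖ (hs h) m t).ae_eq
      ((hz m t).mono fun ω h => h.symm)
  · rw [crossCorr, hv.integral_mul_conj hs hs hz hz, hv.integral_mul_conj hs hs hz hz]
    simp

lemma isSpectrum (hv : IsOrthFamily P D v S) (hs : ↑s ⊆ D)
    (hz : ∀ m t, ∀ᵐ ω ∂P, z m t ω = ∑ ϖ ∈ s, v ϖ m t ω) (m m' : Fin M) :
    IsSpectrum (crossCorr P (z m) (z m')) (fun f => ∑ ϖ ∈ s, S ϖ m m' f) := by
  have h1 := IsSpectrum.sum s (R := fun ϖ => 𝓕⁻ (S ϖ m m')) (S := fun ϖ => S ϖ m m')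
    fun ϖ h => ⟨hv.spec ϖ (hs h) m m', fun _ => rfl⟩
  refine ⟨h1.1, fun τ => ?_⟩
  rw [← h1.2, crossCorr, hv.integral_mul_conj hs hs hz hz]
  simp

end IsOrthFamily

end Filtering

/-! ### The components of the amplified signal -/

section Components

lemma integrable_hermiteKernel {N : ℕ} {b : ℕ → ℝ → ℂ} (hb : ∀ ϖ ∈ oddIcc 1 N, Integrable (b ϖ))
    (σ : ℝ) {ϖ : ℕ} (hϖ : Odd ϖ) : Integrable (hermiteKernel N b σ ϖ) := by
  unfold hermiteKernel
  refine integrable_finsetSum _ fun κ hκ => (hb κ ?_).const_mul _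
  rw [mem_oddIcc] at hκ ⊢
  exact ⟨hϖ.pos.trans_le hκ.1, hκ.2⟩

lemma oddHermite_zero {s : ℂ} {ϖ : ℕ} (hϖ : Odd ϖ) : oddHermite s ϖ 0 = 0 := by
  obtain ⟨n, rfl⟩ := hϖ
  rw [oddHermite_odd, itoHermite_eq_sum]
  refine Finset.sum_eq_zero fun i hi => ?_
  rw [Finset.mem_range] at hi
  rw [zero_pow (by omega : n + 1 - i ≠ 0)]
  ring

lemma continuous_oddHermite (s : ℂ) (ϖ : ℕ) : Continuous (oddHermite s ϖ) :=
  continuous_itoHermite _ _ _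

/-- For `N = 0` the left sum is empty although the term `g 1` remains on the right, hence the side
condition. -/
lemma sum_oddIcc_one {E : Type*} [AddCommMonoid E] {N : ℕ} {g : ℕ → E} (h : N = 0 → g 1 = 0) :
    ∑ ϖ ∈ oddIcc 1 N, g ϖ = g 1 + ∑ ϖ ∈ oddIcc 3 N, g ϖ := by
  rcases Nat.eq_zero_or_pos N with rfl | hN
  · simp [oddIcc, h rfl]
  · have h1 : oddIcc 1 N = insert 1 (oddIcc 3 N) := by
      ext k
      rw [Finset.mem_insert, mem_oddIcc, mem_oddIcc]
      constructor
      · rintro ⟨h1, h2, l, rfl⟩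
        rcases Nat.eq_zero_or_pos l with rfl | hl
        · exact Or.inl rfl
        · exact Or.inr ⟨by omega, h2, l, rfl⟩
      · rintro (rfl | ⟨h1, h2, h3⟩)
        · exact ⟨le_rfl, hN, odd_one⟩
        · exact ⟨by omega, h2, h3⟩
    rw [h1, Finset.sum_insert]
    rw [mem_oddIcc]
    omega

lemma odd_of_mem_oddIcc {l u k : ℕ} (h : k ∈ oddIcc l u) : Odd k := (mem_oddIcc.1 h).2.2

lemma coe_oddIcc_subset (l u : ℕ) : (oddIcc l u : Set ℕ) ⊆ {k | Odd k} :=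
  fun _ h => odd_of_mem_oddIcc (Finset.mem_coe.1 h)

variable {Ω : Type*} [MeasurableSpace Ω] {P : Measure Ω}

lemma IsCircGaussian.circPair {M : ℕ} {x : Fin M → ℝ → Ω → ℂ} (hx : IsCircGaussian x P)
    (m m' : Fin M) (t t' : ℝ) : CircPair P (x m t) (x m' t') := by
  classical
  refine ⟨hx.gaussian.hasGaussianLaw_prodMk (s := (m, t)) (t := (m', t')), fun θ => ?_⟩
  let I : Finset (Fin M × ℝ) := {(m, t), (m', t')}
  let π : (I → ℂ) → ℂ × ℂ := fun f => (f ⟨(m, t), by simp [I]⟩, f ⟨(m', t'), by simp [I]⟩)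
  have hπ : Measurable π := by fun_prop
  have h1 := congrArg (Measure.map π) (hx.circular θ I)
  have hm : ∀ p : Fin M × ℝ, AEMeasurable (fun ω => x p.1 p.2 ω) P := hx.gaussian.aemeasurable
  have hm₁ : AEMeasurable (fun ω => I.restrict
      (fun p : Fin M × ℝ => Complex.exp (θ * Complex.I) * x p.1 p.2 ω)) P :=
    aemeasurable_pi_lambda _ fun p => (hm p.1).const_mul _
  have hm₂ : AEMeasurable (fun ω => I.restrict (fun p : Fin M × ℝ => x p.1 p.2 ω)) P :=
    aemeasurable_pi_lambda _ fun p => hm p.1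
  rw [AEMeasurable.map_map_of_aemeasurable hπ.aemeasurable hm₁,
    AEMeasurable.map_map_of_aemeasurable hπ.aemeasurable hm₂] at h1
  exact h1

variable {M : ℕ} {x : Fin M → ℝ → Ω → ℂ}

lemma IsJointlyWSS.integral_mul_conj (hx : IsJointlyWSS x P) (m m' : Fin M) (t t' : ℝ) :
    ∫ ω, x m t ω * conj (x m' t' ω) ∂P = crossCorr P (x m) (x m') (t - t') := by
  rw [← hx.corr m m' t (t - t'), sub_sub_cancel]

lemma IsJointlyWSS.sq_rms (hx : IsJointlyWSS x P) (m : Fin M) (t : ℝ) :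
    ((rms P (x m) : ℂ)) ^ 2 = (∫ ω, ‖x m t ω‖ ^ 2 ∂P : ℝ) := by
  have h1 : ∀ t, ((∫ ω, ‖x m t ω‖ ^ 2 ∂P : ℝ) : ℂ) = crossCorr P (x m) (x m) 0 := by
    intro t
    rw [← sub_self t, ← hx.integral_mul_conj, ← integral_complex_ofReal]
    congr 1 with ω
    rw [Complex.mul_conj']
    push_cast
    rfl
  rw [rms, ← Complex.ofReal_pow, Real.sq_sqrt (integral_nonneg fun _ => by positivity), h1, h1]

/-- The Itô-Hermite polynomial of degree `ϖ` of the process `X`. -/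
def hermiteSignal (P : Measure Ω) (X : ℝ → Ω → ℂ) (ϖ : ℕ) (τ : ℝ) (ω : Ω) : ℂ :=
  oddHermite ((rms P X : ℂ) ^ 2) ϖ (X τ ω)

/-- The component of degree `ϖ` of the amplified signal. -/
def component (P : Measure Ω) (N : ℕ) (b : ℕ → ℝ → ℂ) (x : Fin M → ℝ → Ω → ℂ) (ϖ : ℕ) (m : Fin M)
    (t : ℝ) : Ω → ℂ :=
  weighted (fun τ => hermiteKernel N b (rms P (x m)) ϖ (t - τ)) (hermiteSignal P (x m) ϖ)

lemma integral_hermiteSignal (hg : IsCircGaussian x P) (hx : IsJointlyWSS x P) {ϖ : ℕ}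
    (hϖ : Odd ϖ) (m : Fin M) (τ : ℝ) : ∫ ω, hermiteSignal P (x m) ϖ τ ω ∂P = 0 := by
  obtain ⟨n, rfl⟩ := hϖ
  simp only [hermiteSignal, oddHermite_odd]
  exact (hg.circPair m m τ τ).integral_itoHermite (hx.sq_rms m τ) n

lemma integral_hermiteSignal_mul_conj_of_ne (hg : IsCircGaussian x P) (hx : IsJointlyWSS x P)
    {ϖ ϖ' : ℕ} (hϖ : Odd ϖ) (hϖ' : Odd ϖ') (hne : ϖ ≠ ϖ') (m m' : Fin M) (τ τ' : ℝ) :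
    ∫ ω, hermiteSignal P (x m) ϖ τ ω * conj (hermiteSignal P (x m') ϖ' τ' ω) ∂P = 0 := by
  obtain ⟨n, rfl⟩ := hϖ
  obtain ⟨n', rfl⟩ := hϖ'
  simp only [hermiteSignal, oddHermite_odd]
  exact (hg.circPair m m' τ τ').integral_itoHermite_mul_conj_of_ne (hx.sq_rms m τ)
    (hx.sq_rms m' τ') (by omega)

lemma integral_hermiteSignal_mul_conj_self (hg : IsCircGaussian x P) (hx : IsJointlyWSS x P)
    {ϖ : ℕ} (hϖ : Odd ϖ) (m m' : Fin M) (τ τ' : ℝ) :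
    ∫ ω, hermiteSignal P (x m) ϖ τ ω * conj (hermiteSignal P (x m') ϖ τ' ω) ∂P =
      termCorr ϖ (crossCorr P (x m) (x m')) (τ - τ') := by
  obtain ⟨n, rfl⟩ := hϖ
  simp only [hermiteSignal, oddHermite_odd]
  rw [(hg.circPair m m' τ τ').integral_itoHermite_mul_conj_self (hx.sq_rms m τ),
    hx.integral_mul_conj, termCorr, termConst, show (2 * n + 1 + 1) / 2 = n + 1 by omega,
    show (2 * n + 1 - 1) / 2 = n by omega, Nat.add_sub_cancel]

/-- The second moment does not depend on time: it is `termCorr` at lag zero, which serves as the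
bound. -/
lemma isBddSignal_hermiteSignal (hmeas : ∀ m, Measurable (Function.uncurry (x m)))
    (hg : IsCircGaussian x P) (hx : IsJointlyWSS x P) {ϖ : ℕ} (hϖ : Odd ϖ) (m : Fin M) :
    IsBddSignal P (hermiteSignal P (x m) ϖ) := by
  have hP : IsProbabilityMeasure P := hg.gaussian.isProbabilityMeasure
  refine ⟨(continuous_oddHermite _ ϖ).measurable.comp (hmeas m), fun τ => ?_,
    (termCorr ϖ (crossCorr P (x m) (x m)) 0).re, fun τ => ?_⟩
  · exact (hg.circPair m m τ τ).allMoments_fst.itoHermite _ _ _ 2 (by simp)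
  · have h1 := integral_hermiteSignal_mul_conj_self hg hx hϖ m m τ τ
    rw [sub_self] at h1
    rw [← h1]
    have h2 : ∀ ω, hermiteSignal P (x m) ϖ τ ω * conj (hermiteSignal P (x m) ϖ τ ω) =
        ((‖hermiteSignal P (x m) ϖ τ ω‖ ^ 2 : ℝ) : ℂ) := by
      intro ω
      rw [Complex.mul_conj', Complex.ofReal_pow]
    simp only [h2]
    rw [integral_complex_ofReal, Complex.ofReal_re]

variable {N : ℕ} {b : ℕ → ℝ → ℂ}

lemma isOrthFamily_component (hmeas : ∀ m, Measurable (Function.uncurry (x m)))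
    (hg : IsCircGaussian x P) (hx : IsJointlyWSS x P)
    (hb : ∀ ϖ ∈ oddIcc 1 N, Integrable (b ϖ)) {S : Fin M → Fin M → ℝ → ℂ}
    (hS : ∀ m m', IsSpectrum (crossCorr P (x m) (x m')) (S m m')) :
    IsOrthFamily P {ϖ | Odd ϖ} (component P N b x) (fun ϖ m m' f =>
      transfer P N b (x m) ϖ f * conj (transfer P N b (x m') ϖ f) * termSpec ϖ (S m m') f) := by
  have hP : IsProbabilityMeasure P := hg.gaussian.isProbabilityMeasure
  have hp : ∀ {ϖ : ℕ}, Odd ϖ → ∀ m, IsBddSignal P (hermiteSignal P (x m) ϖ) :=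
    fun hϖ m => isBddSignal_hermiteSignal hmeas hg hx hϖ m
  have hk : ∀ {ϖ : ℕ}, Odd ϖ → ∀ m, Integrable (hermiteKernel N b (rms P (x m)) ϖ) :=
    fun hϖ m => integrable_hermiteKernel hb _ hϖ
  refine ⟨fun ϖ hϖ m t => ?_, fun ϖ hϖ m t => ?_, fun ϖ hϖ m m' => ?_, fun ϖ hϖ m m' t t' => ?_,
    fun ϖ hϖ ϖ' hϖ' hne m m' t t' => ?_⟩
  · exact (hp hϖ m).memLp_weighted ((hk hϖ m).comp_sub_left t)
  · rw [component, (hp hϖ m).integral_weighted ((hk hϖ m).comp_sub_left t)]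
    simp only [integral_hermiteSignal hg hx hϖ, mul_zero, integral_zero]
  · exact integrable_fourier_mul (hk hϖ m) (hk hϖ m') (isSpectrum_termSpec (hS m m') hϖ).1
  · refine (hp hϖ m).integral_filter_mul_conj (hp hϖ m') (hk hϖ m) (hk hϖ m')
      (isSpectrum_termSpec (hS m m') hϖ).1 (fun τ τ' => ?_) t t'
    rw [integral_hermiteSignal_mul_conj_self hg hx hϖ, (isSpectrum_termSpec (hS m m') hϖ).2]
  · rw [component, component, (hp hϖ m).integral_weighted_mul_conj (hp hϖ' m')
      ((hk hϖ m).comp_sub_left t) ((hk hϖ' m').comp_sub_left t')]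
    simp only [integral_hermiteSignal_mul_conj_of_ne hg hx hϖ hϖ' hne, mul_zero, integral_zero]

/-- Each `x m τ` vanishes almost surely; joint measurability allows the two null-set quantifiers to
be exchanged. -/
lemma ae_ae_eq_zero_of_rms_eq_zero [IsProbabilityMeasure P]
    (hmeas : ∀ m, Measurable (Function.uncurry (x m))) (hx : IsJointlyWSS x P) (m : Fin M)
    (h0 : rms P (x m) = 0) : ∀ᵐ ω ∂P, ∀ᵐ τ : ℝ, x m τ ω = 0 := by
  have h1 : ∀ τ : ℝ, ∀ᵐ ω ∂P, x m τ ω = 0 := by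
    intro τ
    have h2 := hx.sq_rms m τ
    rw [h0] at h2
    have h3 : ∫ ω, ‖x m τ ω‖ ^ 2 ∂P = 0 := by
      have : ((∫ ω, ‖x m τ ω‖ ^ 2 ∂P : ℝ) : ℂ) = 0 := by rw [← h2]; simp
      exact_mod_cast this
    rw [integral_eq_zero_iff_of_nonneg (fun _ => by positivity)
      ((hx.memLp m τ).integrable_norm_pow (by simp))] at h3
    filter_upwards [h3] with ω hω
    simpa using hω
  have hset : MeasurableSet {p : ℝ × Ω | x m p.1 p.2 = 0} :=
    hmeas m (measurableSet_singleton (0 : ℂ))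
  exact (Measure.ae_ae_comm hset).1 (ae_of_all _ h1)

/-- For `σ = 0` the left side vanishes through `0 ^ ϖ`, the right side because an odd Hermite
polynomial vanishes at `0`. -/
lemma ae_ae_hermiteIntegrand_eq [IsProbabilityMeasure P]
    (hmeas : ∀ m, Measurable (Function.uncurry (x m))) (hx : IsJointlyWSS x P) (m : Fin M)
    (N : ℕ) (b : ℕ → ℝ → ℂ) (t : ℝ) :
    ∀ᵐ ω ∂P, ∀ ϖ, Odd ϖ → hermiteIntegrand P N b (x m) ϖ t ω =ᵐ[volume] fun τ =>
      hermiteKernel N b (rms P (x m)) ϖ (t - τ) * hermiteSignal P (x m) ϖ τ ω := by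
  rcases eq_or_ne (rms P (x m)) 0 with h0 | h0
  · filter_upwards [ae_ae_eq_zero_of_rms_eq_zero hmeas hx m h0] with ω hω ϖ hϖ
    filter_upwards [hω] with τ hτ
    simp only [hermiteIntegrand, hermiteSignal, hτ, oddHermite_zero hϖ, h0, Complex.ofReal_zero,
      zero_pow hϖ.pos.ne', zero_mul]
  · refine ae_of_all _ fun ω ϖ hϖ => ae_of_all _ fun τ => ?_
    simp only [hermiteIntegrand, hermiteSignal, pow_mul_hermite_div h0 hϖ]

lemma ae_integrable_component [IsProbabilityMeasure P]
    (hmeas : ∀ m, Measurable (Function.uncurry (x m)))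
    (hg : IsCircGaussian x P) (hx : IsJointlyWSS x P) {a : ℝ → ℂ} (ha : Integrable a) (m : Fin M)
    (t : ℝ) : ∀ᵐ ω ∂P, ∀ ϖ, Odd ϖ →
      Integrable fun τ => a (t - τ) * hermiteSignal P (x m) ϖ τ ω := by
  rw [ae_all_iff]
  intro ϖ
  by_cases hϖ : Odd ϖ
  · filter_upwards [(isBddSignal_hermiteSignal hmeas hg hx hϖ m).ae_integrable
      (ha.comp_sub_left t)] with ω hω _
    exact hω
  · exact ae_of_all _ fun ω h => absurd h hϖ

/-- The monomial is a finite combination of Hermite signals, each with bounded second moments. -/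
lemma ae_integrable_mul_norm_pow [IsProbabilityMeasure P]
    (hmeas : ∀ m, Measurable (Function.uncurry (x m)))
    (hg : IsCircGaussian x P) (hx : IsJointlyWSS x P) {a : ℝ → ℂ} (ha : Integrable a) {κ : ℕ}
    (hκ : Odd κ) (m : Fin M) (t : ℝ) :
    ∀ᵐ ω ∂P, Integrable fun τ => a (t - τ) * (x m τ ω * (‖x m τ ω‖ : ℂ) ^ (κ - 1)) := by
  filter_upwards [ae_integrable_component hmeas hg hx ha m t] with ω hω
  simp only [mul_norm_pow_eq_sum ((rms P (x m) : ℂ) ^ 2) hκ, Finset.mul_sum]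
  refine integrable_finsetSum _ fun ϖ hϖ => ?_
  simp only [mul_left_comm (a _)]
  exact (hω ϖ (odd_of_mem_oddIcc hϖ)).const_mul _

lemma ae_amplifier_eq [IsProbabilityMeasure P]
    (hmeas : ∀ m, Measurable (Function.uncurry (x m)))
    (hg : IsCircGaussian x P) (hx : IsJointlyWSS x P)
    (hb : ∀ ϖ ∈ oddIcc 1 N, Integrable (b ϖ)) (m : Fin M) (t : ℝ) :
    ∀ᵐ ω ∂P, amplifier N b (x m) t ω = ∑ ϖ ∈ oddIcc 1 N, component P N b x ϖ m t ω := by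
  have h1 : ∀ᵐ ω ∂P, ∀ κ ∈ oddIcc 1 N,
      Integrable fun τ => b κ (t - τ) * (x m τ ω * (‖x m τ ω‖ : ℂ) ^ (κ - 1)) :=
    (Finset.eventually_all _).2 fun κ hκ =>
      ae_integrable_mul_norm_pow hmeas hg hx (hb κ hκ) (odd_of_mem_oddIcc hκ) m t
  have h2 : ∀ᵐ ω ∂P, ∀ ϖ ∈ oddIcc 1 N, Integrable fun τ =>
      hermiteKernel N b (rms P (x m)) ϖ (t - τ) * hermiteSignal P (x m) ϖ τ ω := by
    refine (Finset.eventually_all _).2 fun ϖ hϖ => ?_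
    have hodd := odd_of_mem_oddIcc hϖ
    filter_upwards [ae_integrable_component hmeas hg hx
      (integrable_hermiteKernel hb (rms P (x m)) hodd) m t] with ω hω
    exact hω ϖ hodd
  filter_upwards [h1, h2] with ω h1 h2
  simp only [amplifier, component, weighted]
  rw [← integral_finsetSum _ h1, ← integral_finsetSum _ h2]
  congr 1 with τ
  exact (sum_hermiteKernel_mul N b (rms P (x m)) (t - τ) (x m τ ω)).symm

lemma ae_distortion_eq [IsProbabilityMeasure P]
    (hmeas : ∀ m, Measurable (Function.uncurry (x m))) (hx : IsJointlyWSS x P) (m : Fin M)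
    (t : ℝ) :
    ∀ᵐ ω ∂P, distortion P N b (x m) t ω = ∑ ϖ ∈ oddIcc 3 N, component P N b x ϖ m t ω := by
  filter_upwards [ae_ae_hermiteIntegrand_eq hmeas hx m N b t] with ω hω
  exact Finset.sum_congr rfl fun ϖ hϖ => integral_congr_ae (hω ϖ (odd_of_mem_oddIcc hϖ))

lemma linearPart_eq (m : Fin M) (t : ℝ) (ω : Ω) :
    linearPart P N b (x m) t ω = component P N b x 1 m t ω := by
  simp [linearPart, component, weighted, hermiteSignal, oddHermite, itoHermite]

lemma hermiteKernel_zero_left (b : ℕ → ℝ → ℂ) (σ : ℝ) : hermiteKernel 0 b σ 1 = 0 := by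
  funext τ
  simp [hermiteKernel, oddIcc]

lemma termSpec_one (S : ℝ → ℂ) : termSpec 1 S = S := by
  funext f
  simp [termSpec, termConst, iterConv]

end Components

end MemPoly

end

theorem mainTheorem5 {Ω : Type*} [MeasurableSpace Ω] (P : Measure Ω) [IsProbabilityMeasure P]
    (M : ℕ) (x : Fin M → ℝ → Ω → ℂ)
    (hmeas : ∀ m, Measurable (Function.uncurry (x m)))
    (hgauss : MemPoly.IsCircGaussian x P) (hstat : MemPoly.IsJointlyWSS x P)
    (N : ℕ) (b : ℕ → ℝ → ℂ) (hb : ∀ ϖ ∈ MemPoly.oddIcc 1 N, Integrable (b ϖ))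
    (S : Fin M → Fin M → ℝ → ℂ)
    (hS : ∀ m m', MemPoly.IsSpectrum (MemPoly.crossCorr P (x m) (x m')) (S m m'))
    (y u d : Fin M → ℝ → Ω → ℂ)
    (hy : y = fun m => MemPoly.amplifier N b (x m))
    (hu : u = fun m => MemPoly.linearPart P N b (x m))
    (hd : d = fun m => MemPoly.distortion P N b (x m))
    (A : ℕ → Fin M → ℝ → ℂ)
    (hA : A = fun ϖ m => MemPoly.transfer P N b (x m) ϖ) :
    -- the integrals that define the amplified signals converge absolutely
    (∀ m t, ∀ ϖ ∈ MemPoly.oddIcc 1 N, ∀ᵐ ω ∂P,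
      Integrable (fun τ => b ϖ (t - τ) * (x m τ ω * (‖x m τ ω‖ : ℂ) ^ (ϖ - 1))) ∧
      Integrable (MemPoly.hermiteIntegrand P N b (x m) ϖ t ω)) ∧
    (∀ m t, ∀ᵐ ω ∂P, Integrable
      (fun τ => MemPoly.hermiteKernel N b (MemPoly.rms P (x m)) 1 (t - τ) * x m τ ω)) ∧
    -- the amplified signals are the sums of the linear parts and the distortions
    (∀ m t, ∀ᵐ ω ∂P, y m t ω = u m t ω + d m t ω) ∧
    -- all of them are jointly weak-sense stationary
    MemPoly.IsJointlyWSS y P ∧ MemPoly.IsJointlyWSS u P ∧ MemPoly.IsJointlyWSS d P ∧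
    -- linear part and distortion are uncorrelated
    (∀ m m' t τ, ∫ ω, u m t ω * conj (d m' (t - τ) ω) ∂P = 0) ∧
    -- the individual cross-spectra
    (∀ m m', ∀ ϖ ∈ MemPoly.oddIcc 1 N,
      MemPoly.IsSpectrum (MemPoly.termCorr ϖ (MemPoly.crossCorr P (x m) (x m')))
        (MemPoly.termSpec ϖ (S m m'))) ∧
    -- the cross-spectra of the amplified signals
    (∀ m m', MemPoly.IsSpectrum (MemPoly.crossCorr P (y m) (y m'))
      (fun f => ∑ ϖ ∈ MemPoly.oddIcc 1 N,
        A ϖ m f * conj (A ϖ m' f) * MemPoly.termSpec ϖ (S m m') f)) ∧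
    -- the cross-spectra of the linear parts and of the distortions
    (∀ m m', MemPoly.IsSpectrum (MemPoly.crossCorr P (u m) (u m'))
      (fun f => A 1 m f * conj (A 1 m' f) * S m m' f)) ∧
    (∀ m m', MemPoly.IsSpectrum (MemPoly.crossCorr P (d m) (d m'))
      (fun f => ∑ ϖ ∈ MemPoly.oddIcc 3 N,
        A ϖ m f * conj (A ϖ m' f) * MemPoly.termSpec ϖ (S m m') f)) ∧
    -- the partition of the spectrum
    (∀ Syy Suu Sdd : ℝ → Matrix (Fin M) (Fin M) ℂ,
      (∀ m m', MemPoly.IsSpectrum (MemPoly.crossCorr P (y m) (y m')) (fun f => Syy f m m')) →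
      (∀ m m', MemPoly.IsSpectrum (MemPoly.crossCorr P (u m) (u m')) (fun f => Suu f m m')) →
      (∀ m m', MemPoly.IsSpectrum (MemPoly.crossCorr P (d m) (d m')) (fun f => Sdd f m m')) →
      ∀ᵐ f : ℝ, Syy f = Suu f + Sdd f) := by
  subst hy hu hd hA
  have hF := MemPoly.isOrthFamily_component hmeas hgauss hstat hb hS
  have hy : ∀ m t, ∀ᵐ ω ∂P, MemPoly.amplifier N b (x m) t ω =
      ∑ ϖ ∈ MemPoly.oddIcc 1 N, MemPoly.component P N b x ϖ m t ω :=
    fun m t => MemPoly.ae_amplifier_eq hmeas hgauss hstat hb m t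
  -- The index set is `{1}` even for `N = 0`, where the degree 1 kernel is zero.
  have hu : ∀ m t, ∀ᵐ ω ∂P, MemPoly.linearPart P N b (x m) t ω =
      ∑ ϖ ∈ {1}, MemPoly.component P N b x ϖ m t ω := fun m t => ae_of_all _ fun ω => by
    rw [MemPoly.linearPart_eq, Finset.sum_singleton]
  have hd : ∀ m t, ∀ᵐ ω ∂P, MemPoly.distortion P N b (x m) t ω =
      ∑ ϖ ∈ MemPoly.oddIcc 3 N, MemPoly.component P N b x ϖ m t ω :=
    fun m t => MemPoly.ae_distortion_eq hmeas hstat m t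
  have hs1 : ((({1} : Finset ℕ) : Set ℕ)) ⊆ {ϖ | Odd ϖ} := by simp
  have hsy := MemPoly.coe_oddIcc_subset 1 N
  have hsd := MemPoly.coe_oddIcc_subset 3 N
  have hSy := hF.isSpectrum hsy hy
  have hSu := hF.isSpectrum hs1 hu
  have hSd := hF.isSpectrum hsd hd
  simp only [Finset.sum_singleton, MemPoly.termSpec_one] at hSu
  refine ⟨fun m t ϖ hϖ => ?_, fun m t => ?_, fun m t => ?_, hF.isJointlyWSS hsy hy,
    hF.isJointlyWSS hs1 hu, hF.isJointlyWSS hsd hd, fun m m' t τ => ?_,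
    fun m m' ϖ hϖ => MemPoly.isSpectrum_termSpec (hS m m') (MemPoly.odd_of_mem_oddIcc hϖ),
    hSy, hSu, hSd, fun Syy Suu Sdd hyy huu hdd => ?_⟩
  · have hodd := MemPoly.odd_of_mem_oddIcc hϖ
    filter_upwards [MemPoly.ae_integrable_mul_norm_pow hmeas hgauss hstat (hb ϖ hϖ) hodd m t,
      MemPoly.ae_ae_hermiteIntegrand_eq hmeas hstat m N b t,
      MemPoly.ae_integrable_component hmeas hgauss hstat
        (MemPoly.integrable_hermiteKernel hb (MemPoly.rms P (x m)) hodd) m t] with ω h1 h2 h3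
    exact ⟨h1, (h3 ϖ hodd).congr (h2 ϖ hodd).symm⟩
  · filter_upwards [MemPoly.ae_integrable_component hmeas hgauss hstat
      (MemPoly.integrable_hermiteKernel hb (MemPoly.rms P (x m)) odd_one) m t] with ω h
    simpa [MemPoly.hermiteSignal, MemPoly.oddHermite, MemPoly.itoHermite] using h 1 odd_one
  · filter_upwards [hy m t, hd m t] with ω h1 h2
    rw [h1, h2, MemPoly.linearPart_eq]
    refine MemPoly.sum_oddIcc_one (g := fun ϖ => MemPoly.component P N b x ϖ m t ω) ?_
    rintro rfl
    simp [MemPoly.component, MemPoly.weighted, MemPoly.hermiteKernel_zero_left]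
  · rw [hF.integral_mul_conj hs1 hsd hu hd, Finset.singleton_inter_of_notMem, Finset.sum_empty]
    rw [MemPoly.mem_oddIcc]
    omega
  · have hall : ∀ m m', ∀ᵐ f : ℝ, Syy f m m' = Suu f m m' + Sdd f m m' := by
      intro m m'
      filter_upwards [(hyy m m').ae_eq (hSy m m'), (huu m m').ae_eq (hSu m m'),
        (hdd m m').ae_eq (hSd m m')] with f h1 h2 h3
      rw [h1, h2, h3, MemPoly.sum_oddIcc_one, MemPoly.termSpec_one]
      -- For `N = 0` the extra degree 1 term vanishes because the transfer function is that of the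
      -- zero kernel.
      rintro rfl
      rw [MemPoly.transfer, MemPoly.hermiteKernel_zero_left, MemPoly.fourier_eq_integral]
      simp
    filter_upwards [ae_all_iff.2 fun m => ae_all_iff.2 fun m' => hall m m'] with f hf
    ext m m'
    exact hf m m'
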